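/- Let $\varphi:\mathbb R^d\to\mathbb R$ be $K$-Lipschitz ($K\ge0$) and $\lambda$-concave with $\lambda\ge 0$, i.e. $y\mapsto\varphi(y)-\frac\lambda2|y|^2$ is concave. For $\varepsilon,t>0$ let $$u^\varepsilon_t(x)=-\varepsilon\log\left(\frac1{(2\pi\varepsilon t)^{d/2}}\int_{\mathbb R^d}\exp\Big(-\frac{|x-y|^2}{2\varepsilon t}-\frac{\varphi(y)}{\varepsilon}\Big)\,dy\right)$$ be the Cole–Hopf solution of $\partial_tu^\varepsilon+\frac12|\nabla u^\varepsilon|^2=\frac\varepsilon2\Delta u^\varepsilon$ with initial data $\varphi$, and let $$u_t(x)=\inf_{y\in\mathbb R^d}\Big(\frac{|x-y|^2}{2t}+\varphi(y)\Big)$$ be given by the Hopf–Lax formula. Then $u_t$ is $\lambda_t$-concave with $\lambda_t=\lambda/(1+\lambda t)$, and we put $$\partial u_t(x)=\Big\{q\in\mathbb R^d: u_t(z)\le u_t(x)+q\cdot(z-x)+\tfrac12\lambda_t|z-x|^2\ \text{ for all } z\in\mathbb R^d\Big\}.$$ For each $\varepsilon>0$ there is a unique viscous Lagrangian flow $X^\varepsilon:\mathbb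 R^d\times[0,\infty)\to\mathbb R^d$, meaning that for every $y$ the path $t\mapsto X^\varepsilon(y,t)$ is continuous on $[0,\infty)$, $X^\varepsilon(y,0)=y$, and $\partial_tX^\varepsilon(y,t)=\nabla u^\varepsilon_t(X^\varepsilon(y,t))$ for all $t>0$. Moreover: (a) The limit $X(y,t)=\lim_{\varepsilon\to0^+}X^\varepsilon(y,t)$ exists for each $y\in\mathbb R^d$, $t\ge0$, with uniform convergence on every compact subset of $\mathbb R^d\times[0,\infty)$. (b) For each $t\ge0$, $X_t=X(\cdot,t)$ maps $\mathbb R^d$ onto $\mathbb R^d$. (c) $X$ is locally Lipschitz on $\mathbb R^d\times[0,\infty)$, and more precisely: (i) for each $y$ the path $t\mapsto X_t(y)$ is $K$-Lipschitz on $[0,\infty)$; (ii) whenever $0\le s<t$, for all $y,z\in\mathbb R^d$, $$\frac{|X_t(y)-X_t(z)|}{1+\lambda t}\le\frac{|X_s(y)-X_s(z)|}{1+\lambda s}\le|y-z|,$$ and if $X_s(y)=X_s(z)$ for some $s\ge0$, then $X_t(y)=X_t(z)$ for all $t\ge s$. (d) For each $y\in\mathbb R^d$ the path $t\mapsto X_t(y)$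 is the unique Lipschitz function $x:[0,\infty)\to\mathbb R^d$ with $x_0=y$ and $\partial_tx_t\in\partial u_t(x_t)$ for a.e. $t>0$. -/

import Mathlib

open scoped NNReal

noncomputable section

namespace Adhesion

/-- Euclidean space `ℝ^d`. -/
abbrev Space (d : ℕ) : Type := EuclideanSpace ℝ (Fin d)

variable {d : ℕ}

/-- `f` is `lam`-concave: `y ↦ f y - (lam / 2) |y|²` is concave on `ℝ^d`. -/
def LambdaConcave (lam : ℝ) (f : Space d → ℝ) : Prop :=
  ConcaveOn ℝ Set.univ (fun y => f y - lam / 2 * ‖y‖ ^ 2)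

/-- The viscous potential `u^ε_t(x)`, for `ε, t > 0`, by the Cole-Hopf formula. -/
def viscousPotential (φ : Space d → ℝ) (ε t : ℝ) (x : Space d) : ℝ :=
  -ε * Real.log (1 / (2 * Real.pi * ε * t) ^ ((d : ℝ) / 2) *
    ∫ y : Space d, Real.exp (-‖x - y‖ ^ 2 / (2 * ε * t) - φ y / ε))

/-- `Z` is the Lagrangian flow, on the time interval `[0, ∞)`, of the viscous velocity field
`v^ε_t = ∇ u^ε_t`: each path `t ↦ Z y t` is continuous on `[0, ∞)`, starts at `y`, and satisfies
the differential equation at every `t > 0`. (The initial potential need not be differentiable, so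
the velocity is only defined for `t > 0`.) -/
structure IsViscousFlow (φ : Space d → ℝ) (ε : ℝ) (Z : Space d → ℝ → Space d) : Prop where
  initial : ∀ y, Z y 0 = y
  continuousOn : ∀ y, ContinuousOn (Z y) (Set.Ici 0)
  hasDerivAt : ∀ y, ∀ t > 0,
    HasDerivAt (Z y) (gradient (viscousPotential φ ε t) (Z y t)) t

/-- The inviscid potential `u_t(x)`, for `t > 0`, by the Hopf-Lax formula. -/
def hopfLax (φ : Space d → ℝ) (t : ℝ) (x : Space d) : ℝ :=
  ⨅ y : Space d, (‖x - y‖ ^ 2 / (2 * t) + φ y)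

/-- The differential `∂f(x)` of a `mu`-concave function `f`: the slopes at `x` of the paraboloids
with Hessian `mu • I` that lie above the graph of `f` and touch it at `x`. -/
def differential (mu : ℝ) (f : Space d → ℝ) (x : Space d) : Set (Space d) :=
  {q | ∀ z, f z ≤ f x + inner ℝ q (z - x) + mu / 2 * ‖z - x‖ ^ 2}

/-- `x` is a Lipschitz solution on `[0, ∞)` of the differential inclusion `∂_t x_t ∈ ∂u_t(x_t)`
for a.e. `t > 0`, `x_0 = y`, where `u_t` is the Hopf-Lax potential of the `lam`-concave function
`φ`; this `u_t` is `lam / (1 + lam * t)`-concave. -/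
structure IsLipschitzSolution (φ : Space d → ℝ) (lam : ℝ) (y : Space d) (x : ℝ → Space d) :
    Prop where
  lipschitz : ∃ L : ℝ≥0, LipschitzOnWith L x (Set.Ici 0)
  initial : x 0 = y
  inclusion : ∀ᵐ t ∂(MeasureTheory.volume.restrict (Set.Ioi (0 : ℝ))),
    ∃ v ∈ differential (lam / (1 + lam * t)) (hopfLax φ t) (x t), HasDerivAt x v t

end Adhesion

end

/-
Multiplying the Cole-Hopf integral by a Gaussian and completing the square writes
`λ_t |x|² / 2 - u^ε_t(x)` as `ε log ∫ exp`, up to a constant, of a family of convex functions of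
`x`, so `u^ε_t` is `λ_t`-concave with `λ_t = λ / (1 + λ t)`. Slopes `p`, `q` of two `λ_t`-concave
functions at `x`, `y` satisfy `⟨x - y, p - q⟩ ≤ λ_t |x - y|² + 2 δ` when the functions differ by at
most `δ`. Hence along two trajectories `|x_t - y_t|² / (1 + λ t)²` has derivative at most `4 δ`:
for equal potentials this is the contraction estimate and uniqueness, and for `u^ε` and `u^ε'`,
which Laplace's method shows to be uniformly close on `(0, T] × ℝ^d`, it makes the viscous flows
uniformly Cauchy.

The viscous flow itself exists because in the time `s = √t` its velocity is bounded and Lipschitz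
up to `s = 0`. The limit paths solve the differential inclusion because the slope inequality passes
to the limit, and the limit maps are onto since a uniform limit of surjections has dense range,
which is closed as the limit stays within bounded distance of the identity.
-/

noncomputable section

namespace Adhesion

open MeasureTheory Set Filter Topology

section GaussianIntegrals

variable {V : Type*} [NormedAddCommGroup V] [InnerProductSpace ℝ V] [FiniteDimensional ℝ V]
  [MeasurableSpace V] [BorelSpace V] {a : ℝ}

theorem integrable_exp_neg_mul_sq_norm (ha : 0 < a) :
    Integrable fun z : V => Real.exp (-a * ‖z‖ ^ 2) :=
  .of_integral_ne_zero <| by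
    rw [GaussianFourier.integral_rexp_neg_mul_sq_norm ha]
    positivity

theorem integrable_exp_neg_mul_sq_norm_add (ha : 0 < a) (b : ℝ) :
    Integrable fun z : V => Real.exp (-a * ‖z‖ ^ 2 + b * ‖z‖) := by
  refine ((integrable_exp_neg_mul_sq_norm (V := V) (half_pos ha)).const_mul
    (Real.exp (b ^ 2 / (2 * a)))).mono' (by fun_prop) (ae_of_all _ fun z => ?_)
  rw [Real.norm_eq_abs, Real.abs_exp, ← Real.exp_add, Real.exp_le_exp, ← sub_nonneg]
  have hsq : b ^ 2 / (2 * a) + -(a / 2) * ‖z‖ ^ 2 - (-a * ‖z‖ ^ 2 + b * ‖z‖) =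
      (a * ‖z‖ - b) ^ 2 / (2 * a) := by
    field_simp
    ring
  rw [hsq]
  positivity

theorem integrable_exp_neg_mul_sq_norm_add_inner (ha : 0 < a) (c : V) :
    Integrable fun z : V => Real.exp (-a * ‖z‖ ^ 2 + inner ℝ c z) := by
  refine (integrable_exp_neg_mul_sq_norm_add ha ‖c‖).mono' (by fun_prop) (ae_of_all _ fun z => ?_)
  rw [Real.norm_eq_abs, Real.abs_exp, Real.exp_le_exp]
  gcongr
  exact real_inner_le_norm c z

theorem integral_exp_neg_mul_sq_norm_le_add_inner (ha : 0 < a) (c : V) :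
    (Real.pi / a) ^ ((Module.finrank ℝ V : ℝ) / 2) ≤
      ∫ z : V, Real.exp (-a * ‖z‖ ^ 2 + inner ℝ c z) := by
  have hinner : Integrable fun z : V => Real.exp (-a * ‖z‖ ^ 2) * inner ℝ c z := by
    refine ((integrable_exp_neg_mul_sq_norm_add ha 1).const_mul ‖c‖).mono'
      (by fun_prop) (ae_of_all _ fun z => ?_)
    rw [norm_mul, Real.norm_eq_abs, Real.abs_exp, one_mul, Real.exp_add, mul_left_comm]
    gcongr
    calc ‖inner ℝ c z‖ ≤ ‖c‖ * ‖z‖ := norm_inner_le_norm c z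
      _ ≤ ‖c‖ * Real.exp ‖z‖ := by
        gcongr
        linarith [Real.add_one_le_exp ‖z‖]
  have hodd : ∫ z : V, Real.exp (-a * ‖z‖ ^ 2) * inner ℝ c z = 0 := by
    have h := integral_neg_eq_self (fun z : V => Real.exp (-a * ‖z‖ ^ 2) * inner ℝ c z) volume
    simp only [norm_neg, inner_neg_right, mul_neg, integral_neg] at h
    linarith
  calc (Real.pi / a) ^ ((Module.finrank ℝ V : ℝ) / 2)
      = ∫ z : V, Real.exp (-a * ‖z‖ ^ 2) + Real.exp (-a * ‖z‖ ^ 2) * inner ℝ c z := by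
        rw [integral_add (integrable_exp_neg_mul_sq_norm ha) hinner, hodd, add_zero,
          GaussianFourier.integral_rexp_neg_mul_sq_norm ha]
    _ ≤ ∫ z : V, Real.exp (-a * ‖z‖ ^ 2 + inner ℝ c z) := by
        refine integral_mono ((integrable_exp_neg_mul_sq_norm ha).add hinner)
          (integrable_exp_neg_mul_sq_norm_add_inner ha c) fun z => ?_
        rw [Real.exp_add]
        nlinarith [Real.add_one_le_exp (inner ℝ c z), Real.exp_pos (-a * ‖z‖ ^ 2)]

end GaussianIntegrals

theorem convexOn_log_integral_exp {E α : Type*} [AddCommGroup E] [Module ℝ E] [MeasurableSpace α]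
    {μ : Measure α} [NeZero μ] {s : Set E} {g : E → α → ℝ} (hs : Convex ℝ s)
    (hconv : ∀ z, ConvexOn ℝ s fun x => g x z)
    (hint : ∀ x ∈ s, Integrable (fun z => Real.exp (g x z)) μ) :
    ConvexOn ℝ s fun x => Real.log (∫ z, Real.exp (g x z) ∂μ) := by
  refine ⟨hs, fun x hx y hy a b ha hb hab => ?_⟩
  have hi := hint _ (hs hx hy ha hb hab)
  have hix := hint x hx
  have hiy := hint y hy
  set I := ∫ z, Real.exp (g x z) ∂μ
  set J := ∫ z, Real.exp (g y z) ∂μ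
  have hI : 0 < I := integral_exp_pos hix
  have hJ : 0 < J := integral_exp_pos hiy
  simp only [smul_eq_mul]
  rw [Real.log_le_iff_le_exp (integral_exp_pos hi)]
  set M := Real.exp (a * Real.log I + b * Real.log J) with hM
  have hpointwise (z : α) : Real.exp (g (a • x + b • y) z) ≤
      M * (a * (Real.exp (g x z) / I) + b * (Real.exp (g y z) / J)) := by
    have hexp := convexOn_exp.2 (mem_univ (g x z - Real.log I)) (mem_univ (g y z - Real.log J))
      ha hb hab
    simp only [smul_eq_mul, Real.exp_sub, Real.exp_log hI, Real.exp_log hJ] at hexp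
    refine le_trans ?_ (mul_le_mul_of_nonneg_left hexp (Real.exp_nonneg _))
    rw [hM, ← Real.exp_add, Real.exp_le_exp]
    have := (hconv z).2 hx hy ha hb hab
    simp only [smul_eq_mul] at this
    linarith
  calc ∫ z, Real.exp (g (a • x + b • y) z) ∂μ
      ≤ ∫ z, M * (a * (Real.exp (g x z) / I) + b * (Real.exp (g y z) / J)) ∂μ :=
        integral_mono hi
          ((((hix.div_const I).const_mul a).add ((hiy.div_const J).const_mul b)).const_mul M)
          hpointwise
    _ = M * (a * (I / I) + b * (J / J)) := by
        rw [integral_const_mul, integral_add ((hix.div_const I).const_mul a)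
          ((hiy.div_const J).const_mul b), integral_const_mul, integral_const_mul,
          integral_div, integral_div]
    _ = M := by rw [div_self hI.ne', div_self hJ.ne', mul_one, mul_one, hab, mul_one]

theorem hasGradientAt_integral_of_dominated_of_gradient_le {E α : Type*} [NormedAddCommGroup E]
    [InnerProductSpace ℝ E] [CompleteSpace E] [MeasurableSpace α] {μ : Measure α}
    {F : E → α → ℝ} {G : E → α → E} {bound : α → ℝ} {x₀ : E} {s : Set E} (hs : s ∈ 𝓝 x₀)
    (hF_meas : ∀ᶠ x in 𝓝 x₀, AEStronglyMeasurable (F x) μ) (hF_int : Integrable (F x₀) μ)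
    (hG_meas : AEStronglyMeasurable (G x₀) μ) (h_bound : ∀ z, ∀ x ∈ s, ‖G x z‖ ≤ bound z)
    (bound_integrable : Integrable bound μ)
    (h_diff : ∀ z, ∀ x ∈ s, HasGradientAt (fun x => F x z) (G x z) x) :
    HasGradientAt (fun x => ∫ z, F x z ∂μ) (∫ z, G x₀ z ∂μ) x₀ := by
  have hG_int : Integrable (G x₀) μ :=
    bound_integrable.mono' hG_meas (ae_of_all _ fun z => h_bound z x₀ (mem_of_mem_nhds hs))
  have hdual : InnerProductSpace.toDual ℝ E (∫ z, G x₀ z ∂μ) =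
      ∫ z, InnerProductSpace.toDual ℝ E (G x₀ z) ∂μ :=
    ((InnerProductSpace.toDual ℝ E).toContinuousLinearEquiv.toContinuousLinearMap.integral_comp_comm
      hG_int).symm
  rw [hasGradientAt_iff_hasFDerivAt, hdual]
  exact hasFDerivAt_integral_of_dominated_of_fderiv_le (𝕜 := ℝ) hs hF_meas hF_int
    ((InnerProductSpace.toDual ℝ E).continuous.comp_aestronglyMeasurable hG_meas)
    (ae_of_all _ fun z x hx => by
      rw [LinearIsometryEquiv.norm_map]
      exact h_bound z x hx)
    bound_integrable (ae_of_all _ fun z x hx => (h_diff z x hx).hasFDerivAt)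

theorem abs_exp_sub_exp_le {a b M : ℝ} (ha : a ≤ M) (hb : b ≤ M) :
    |Real.exp a - Real.exp b| ≤ |a - b| * Real.exp M := by
  have h := (convex_Iic M).norm_image_sub_le_of_norm_deriv_le (f := Real.exp) (C := Real.exp M)
    (fun x _ => Real.differentiableAt_exp) (fun x hx => by simpa using hx) hb ha
  simpa [mul_comm] using h

section WeightedMean

variable {α E : Type*} [MeasurableSpace α] {μ : Measure α} [NormedAddCommGroup E]
  [NormedSpace ℝ E] {w v : α → ℝ} {g : α → E}

/-- The mean of `g` with respect to the probability measure of density proportional to the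
weight `w`; it has the junk value `0` when `∫ w = 0` or `w • g` is not integrable. -/
def weightedMean (μ : Measure α) (w : α → ℝ) (g : α → E) : E :=
  (∫ z, w z ∂μ)⁻¹ • ∫ z, w z • g z ∂μ

theorem integral_smul_weightedMean (hw : ∫ z, w z ∂μ ≠ 0) :
    (∫ z, w z ∂μ) • weightedMean μ w g = ∫ z, w z • g z ∂μ := by
  rw [weightedMean, smul_inv_smul₀ hw]

theorem weightedMean_const_mul {c : ℝ} (hc : c ≠ 0) :
    weightedMean μ (fun z => c * w z) g = weightedMean μ w g := by
  simp only [weightedMean, integral_const_mul, mul_smul, integral_smul]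
  rw [mul_inv, smul_smul, mul_right_comm, inv_mul_cancel₀ hc, one_mul]

theorem weightedMean_const_smul (c : ℝ) :
    weightedMean μ w (fun z => c • g z) = c • weightedMean μ w g := by
  simp only [weightedMean, smul_comm _ c, integral_smul]

theorem norm_weightedMean_le {m : ℝ} {k : α → ℝ} (hm : 0 < m) (hmw : m ≤ ∫ z, w z ∂μ)
    (hk : Integrable k μ) (hwk : ∀ z, ‖w z • g z‖ ≤ k z) :
    ‖weightedMean μ w g‖ ≤ m⁻¹ * ∫ z, k z ∂μ := by
  have hle : ‖∫ z, w z • g z ∂μ‖ ≤ ∫ z, k z ∂μ :=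
    norm_integral_le_of_norm_le hk (ae_of_all _ hwk)
  rw [weightedMean, norm_smul, norm_inv, Real.norm_eq_abs, abs_of_pos (hm.trans_le hmw)]
  gcongr

-- Rests on the identity `(∫ w) • (mean w - mean v) = ∫ (w - v) • (g - mean v)`.
theorem norm_weightedMean_sub_le [CompleteSpace E] {m : ℝ} {k : α → ℝ} (hm : 0 < m)
    (hmw : m ≤ ∫ z, w z ∂μ) (hv : ∫ z, v z ∂μ ≠ 0) (hwi : Integrable w μ) (hvi : Integrable v μ)
    (hwg : Integrable (fun z => w z • g z) μ) (hvg : Integrable (fun z => v z • g z) μ)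
    (hk : Integrable k μ)
    (hwk : ∀ z, |w z - v z| * (‖g z‖ + ‖weightedMean μ v g‖) ≤ k z) :
    ‖weightedMean μ w g - weightedMean μ v g‖ ≤ m⁻¹ * ∫ z, k z ∂μ := by
  have hpos : 0 < ∫ z, w z ∂μ := hm.trans_le hmw
  set q := weightedMean μ v g with hq
  have hident : (∫ z, w z ∂μ) • (weightedMean μ w g - q) = ∫ z, (w z - v z) • (g z - q) ∂μ := by
    have hwq (z : α) : (w z - v z) • (g z - q) = (w z • g z - w z • q) - (v z • g z - v z • q) := by
      module
    simp_rw [hwq]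
    rw [integral_sub (by exact hwg.sub (hwi.smul_const q)) (by exact hvg.sub (hvi.smul_const q)),
      integral_sub hwg (hwi.smul_const q), integral_sub hvg (hvi.smul_const q), integral_smul_const,
      integral_smul_const, smul_sub, integral_smul_weightedMean hpos.ne', hq,
      integral_smul_weightedMean hv, sub_self, sub_zero]
  have hle : ‖∫ z, (w z - v z) • (g z - q) ∂μ‖ ≤ ∫ z, k z ∂μ := by
    refine norm_integral_le_of_norm_le hk (ae_of_all _ fun z => (hwk z).trans' ?_)
    rw [norm_smul, Real.norm_eq_abs]
    gcongr
    exact norm_sub_le _ _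
  rw [← inv_smul_smul₀ hpos.ne' (weightedMean μ w g - q), hident, norm_smul, norm_inv,
    Real.norm_eq_abs, abs_of_pos hpos]
  gcongr

end WeightedMean

theorem sub_le_mul_of_ae_deriv_le {h : ℝ → ℝ} {a b c : ℝ} (hab : a ≤ b)
    (hh : AbsolutelyContinuousOnInterval h a b) (hd : ∀ᵐ t, t ∈ Ioo a b → deriv h t ≤ c) :
    h b - h a ≤ c * (b - a) :=
  calc h b - h a = ∫ t in a..b, deriv h t := hh.integral_deriv_eq_sub.symm
    _ ≤ ∫ _ in a..b, c := by
      refine intervalIntegral.integral_mono_ae_restrict hab hh.intervalIntegrable_deriv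
        intervalIntegrable_const ?_
      rw [← restrict_Ioo_eq_restrict_Icc]
      exact (ae_restrict_iff' measurableSet_Ioo).2 hd
    _ = c * (b - a) := by rw [intervalIntegral.integral_const, smul_eq_mul, mul_comm]

theorem le_deriv_of_tendsto {ι : Type*} {l : Filter ι} [l.NeBot] {h : ι → ℝ → ℝ} {H : ℝ → ℝ}
    {c w t : ℝ} (hc : ∀ᶠ p in l ×ˢ 𝓝 t, ∃ w ≥ c, HasDerivAt (h p.1) w p.2)
    (hlim : ∀ᶠ s in 𝓝 t, Tendsto (h · s) l (𝓝 (H s))) (hH : HasDerivAt H w t) : c ≤ w := by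
  obtain ⟨P, hP, Q, hQ, hPQ⟩ := eventually_prod_iff.1 hc
  obtain ⟨r, hr, hball⟩ := Metric.eventually_nhds_iff_ball.1 (hQ.and hlim)
  have ht : t ∈ Metric.ball t r := Metric.mem_ball_self hr
  have hincr (s : ℝ) (hs : s ∈ Metric.ball t r) (hts : t ≤ s) : c * (s - t) ≤ H s - H t := by
    refine ge_of_tendsto ((hball s hs).2.sub (hball t ht).2) (hP.mono fun i hi => ?_)
    have hderiv (q : ℝ) (hq : q ∈ Metric.ball t r) : ∃ w ≥ c, HasDerivAt (h i) w q :=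
      hPQ hi (hball q hq).1
    have hdiff : DifferentiableOn ℝ (h i) (Metric.ball t r) := fun q hq =>
      (hderiv q hq).choose_spec.2.differentiableAt.differentiableWithinAt
    refine (convex_ball t r).mul_sub_le_image_sub_of_le_deriv hdiff.continuousOn
      (hdiff.mono interior_subset) (fun q hq => ?_) t ht s hs hts
    obtain ⟨w, hcw, hw⟩ := hderiv q (interior_subset hq)
    exact hw.deriv ▸ hcw
  have hslope : Tendsto (slope H t) (𝓝[>] t) (𝓝 w) :=
    (hasDerivWithinAt_iff_tendsto_slope' self_notMem_Ioi).1 hH.hasDerivWithinAt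
  refine ge_of_tendsto hslope ?_
  filter_upwards [self_mem_nhdsWithin, mem_nhdsWithin_of_mem_nhds (Metric.ball_mem_nhds t hr)]
    with s hts hs
  rw [slope_def_field, le_div_iff₀ (sub_pos.2 hts)]
  exact hincr s hs (le_of_lt hts)

theorem exists_hasDerivWithinAt_of_bounded_of_lipschitz {E : Type*} [NormedAddCommGroup E]
    [NormedSpace ℝ E] [CompleteSpace E] {f : ℝ → E → E} {a b t₀ : ℝ} {M C : ℝ≥0}
    (hM : ∀ t ∈ Icc a b, ∀ x, ‖f t x‖ ≤ M) (hC : ∀ t ∈ Icc a b, LipschitzWith C (f t))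
    (hcont : ∀ x, ContinuousOn (f · x) (Icc a b)) (ht₀ : t₀ ∈ Icc a b) (y : E) :
    ∃ x : ℝ → E, x t₀ = y ∧ ∀ t ∈ Icc a b, HasDerivWithinAt x (f t (x t)) (Icc a b) t := by
  have hPL : IsPicardLindelof f (⟨t₀, ht₀⟩ : Icc a b) y (M * (b - a).toNNReal) 0 M C := by
    refine ⟨fun t ht => (hC t ht).lipschitzOnWith, fun x _ => hcont x,
      fun t ht x _ => hM t ht x, ?_⟩
    rw [NNReal.coe_zero, sub_zero, NNReal.coe_mul,
      Real.coe_toNNReal _ (sub_nonneg.2 (ht₀.1.trans ht₀.2))]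
    exact mul_le_mul_of_nonneg_left (max_le (by linarith [ht₀.1]) (by linarith [ht₀.2])) M.2
  exact hPL.exists_eq_forall_mem_Icc_hasDerivWithinAt₀

theorem denseRange_of_tendstoUniformly {ι X Y : Type*} [PseudoMetricSpace Y] {l : Filter ι}
    [l.NeBot] {F : ι → X → Y} {f : X → Y} (hF : TendstoUniformly F f l)
    (hsurj : ∀ᶠ i in l, Function.Surjective (F i)) : DenseRange f := by
  refine fun z => Metric.mem_closure_range_iff.2 fun r hr => ?_
  obtain ⟨i, hi, hdist⟩ := (hsurj.and (Metric.tendstoUniformly_iff.1 hF r hr)).exists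
  obtain ⟨y, rfl⟩ := hi z
  exact ⟨y, dist_comm (f y) _ ▸ hdist y⟩

theorem isClosedMap_of_norm_sub_le {E : Type*} [NormedAddCommGroup E] [ProperSpace E]
    {f : E → E} {R : ℝ} (hf : Continuous f) (hR : ∀ y, ‖f y - y‖ ≤ R) : IsClosedMap f := by
  refine (isProperMap_iff_tendsto_cocompact.2 ⟨hf, ?_⟩).isClosedMap
  rw [← Metric.cobounded_eq_cocompact, ← tendsto_norm_atTop_iff_cobounded]
  refine tendsto_atTop_mono (fun y => ?_) (tendsto_atTop_add_const_right _ (-R)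
    tendsto_norm_cobounded_atTop)
  linarith [norm_le_norm_add_norm_sub' y (f y), norm_sub_rev y (f y), hR y]

theorem surjective_of_tendstoUniformly {ι E : Type*} [NormedAddCommGroup E] [ProperSpace E]
    {l : Filter ι} [l.NeBot] {F : ι → E → E} {f : E → E} {R : ℝ} (hF : TendstoUniformly F f l)
    (hsurj : ∀ᶠ i in l, Function.Surjective (F i)) (hf : Continuous f)
    (hR : ∀ y, ‖f y - y‖ ≤ R) : Function.Surjective f := by
  rw [← range_eq_univ, ← (isClosedMap_of_norm_sub_le hf hR).isClosed_range.closure_eq]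
  exact (denseRange_of_tendstoUniformly hF hsurj).closure_eq

theorem tendsto_comp_prod_of_tendstoUniformlyOn {ι κ X Y : Type*} [TopologicalSpace X]
    [UniformSpace Y] {l : Filter ι} {m : Filter κ} {F : ι → X → Y} {f : X → Y} {s : Set X} {a : X}
    (hF : TendstoUniformlyOn F f l s) (hs : s ∈ 𝓝 a) (hf : ContinuousAt f a) {g : ι × κ → X}
    (hg : Tendsto g (l ×ˢ m) (𝓝 a)) :
    Tendsto (fun p => F p.1 (g p)) (l ×ˢ m) (𝓝 (f a)) :=
  tendsto_comp_of_locally_uniform_limit (F := fun p : ι × κ => F p.1) hf hg fun u hu =>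
    ⟨s, hs, (hF u hu).prod_inl m⟩

theorem lipschitzOnWith_prod {α β γ : Type*} [PseudoEMetricSpace α] [PseudoEMetricSpace β]
    [PseudoEMetricSpace γ] {f : α → β → γ} {s : Set α} {t : Set β} {C D : ℝ≥0}
    (hs : ∀ b ∈ t, LipschitzOnWith C (f · b) s) (ht : ∀ a ∈ s, LipschitzOnWith D (f a) t) :
    LipschitzOnWith (C + D) (fun p : α × β => f p.1 p.2) (s ×ˢ t) := by
  rintro ⟨a, b⟩ ⟨ha, hb⟩ ⟨a', b'⟩ ⟨ha', hb'⟩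
  rw [ENNReal.coe_add, add_mul]
  exact (edist_triangle _ (f a' b) _).trans (add_le_add
    ((hs b hb ha ha').trans (mul_right_mono (le_max_left _ _)))
    ((ht a' ha' hb hb').trans (mul_right_mono (le_max_right _ _))))

variable {d : ℕ} {φ : Space d → ℝ} {K : ℝ≥0} {lam ε t : ℝ}

theorem le_add_mul_norm_of_lipschitzWith {E : Type*} [SeminormedAddCommGroup E] {f : E → ℝ}
    (hf : LipschitzWith K f) (x y : E) : f x ≤ f y + K * ‖x - y‖ := by
  simpa only [dist_eq_norm] using hf.le_add_mul x y

section ColeHopf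

/-- The unnormalized density of the Gibbs measure whose mass defines `viscousPotential`. -/
def gibbsDensity (φ : Space d → ℝ) (ε t : ℝ) (x y : Space d) : ℝ :=
  Real.exp (-‖x - y‖ ^ 2 / (2 * ε * t) - φ y / ε)

theorem gibbsDensity_pos (φ : Space d → ℝ) (ε t : ℝ) (x y : Space d) :
    0 < gibbsDensity φ ε t x y := Real.exp_pos _

theorem continuous_gibbsDensity (hφ : Continuous φ) (x : Space d) :
    Continuous (gibbsDensity φ ε t x) := by
  unfold gibbsDensity
  fun_prop

theorem gibbsDensity_le (hLip : LipschitzWith K φ) (hε : 0 < ε) (ht : 0 < t)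
    {x₀ x : Space d} (hx : ‖x - x₀‖ ≤ 1) (y : Space d) :
    gibbsDensity φ ε t x y ≤ Real.exp (1 / (2 * ε * t) - φ x₀ / ε) *
      Real.exp (-(1 / (4 * ε * t)) * ‖x₀ - y‖ ^ 2 + K / ε * ‖x₀ - y‖) := by
  rw [gibbsDensity, ← Real.exp_add, Real.exp_le_exp]
  have hφ : φ x₀ / ε ≤ φ y / ε + K / ε * ‖x₀ - y‖ := by
    rw [div_mul_eq_mul_div, ← add_div]
    gcongr
    exact le_add_mul_norm_of_lipschitzWith hLip x₀ y
  have hsq : ‖x₀ - y‖ ^ 2 ≤ 2 * ‖x - y‖ ^ 2 + 2 := by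
    have htri : ‖x₀ - y‖ ≤ ‖x - y‖ + 1 := by
      linarith [norm_sub_le_norm_sub_add_norm_sub x₀ x y, norm_sub_rev x₀ x]
    nlinarith [sq_nonneg (‖x - y‖ - 1), norm_nonneg (x₀ - y)]
  have hgauss : -‖x - y‖ ^ 2 / (2 * ε * t) ≤
      1 / (2 * ε * t) - 1 / (4 * ε * t) * ‖x₀ - y‖ ^ 2 := by
    rw [← sub_nonneg]
    have hdiff : 1 / (2 * ε * t) - 1 / (4 * ε * t) * ‖x₀ - y‖ ^ 2 - -‖x - y‖ ^ 2 / (2 * ε * t) =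
        (2 * ‖x - y‖ ^ 2 + 2 - ‖x₀ - y‖ ^ 2) / (4 * ε * t) := by
      field_simp
      ring
    rw [hdiff]
    exact div_nonneg (by linarith) (by positivity)
  linarith

theorem integrable_gibbsDensity (hLip : LipschitzWith K φ) (hε : 0 < ε) (ht : 0 < t)
    (x : Space d) : Integrable (gibbsDensity φ ε t x) := by
  refine (((integrable_exp_neg_mul_sq_norm_add (a := 1 / (4 * ε * t)) (by positivity)
    (K / ε)).comp_sub_left x).const_mul (Real.exp (1 / (2 * ε * t) - φ x / ε))).mono'
    (continuous_gibbsDensity hLip.continuous x).aestronglyMeasurable (ae_of_all _ fun y => ?_)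
  rw [Real.norm_eq_abs, abs_of_pos (gibbsDensity_pos ..)]
  exact gibbsDensity_le hLip hε ht (by simp) y

theorem integral_gibbsDensity_pos (hLip : LipschitzWith K φ) (hε : 0 < ε) (ht : 0 < t)
    (x : Space d) : 0 < ∫ y, gibbsDensity φ ε t x y :=
  integral_exp_pos (integrable_gibbsDensity hLip hε ht x)

theorem viscousPotential_eq (hLip : LipschitzWith K φ) (hε : 0 < ε) (ht : 0 < t) (x : Space d) :
    viscousPotential φ ε t x = ε * ((d : ℝ) / 2) * Real.log (2 * Real.pi * ε * t) -
      ε * Real.log (∫ y, gibbsDensity φ ε t x y) := by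
  have hpos : 0 < 2 * Real.pi * ε * t := by positivity
  change -ε * Real.log (1 / (2 * Real.pi * ε * t) ^ ((d : ℝ) / 2) *
    ∫ y, gibbsDensity φ ε t x y) = _
  rw [Real.log_mul (by positivity) (integral_gibbsDensity_pos hLip hε ht x).ne', one_div,
    Real.log_inv, Real.log_rpow hpos]
  ring

theorem hasGradientAt_gibbsDensity (hε : 0 < ε) (ht : 0 < t) (x y : Space d) :
    HasGradientAt (fun x => gibbsDensity φ ε t x y)
      (-(gibbsDensity φ ε t x y / (ε * t)) • (x - y)) x := by
  rw [hasGradientAt_iff_hasFDerivAt]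
  have hsq : HasFDerivAt (fun x : Space d => ‖x - y‖ ^ 2) _ x :=
    ((hasFDerivAt_id x).sub_const y).norm_sq
  simp only [gibbsDensity, div_eq_mul_inv]
  refine ((hsq.neg.mul_const (2 * ε * t)⁻¹).sub_const (φ y * ε⁻¹)).exp.congr_fderiv ?_
  ext v
  simp only [Pi.neg_apply, neg_mul, id_eq, map_sub, ContinuousLinearMap.comp_id, smul_neg,
    neg_apply, smul_apply, sub_apply, coe_innerSL_apply, nsmul_eq_mul, Nat.cast_ofNat, smul_eq_mul,
    neg_smul, map_neg, map_smul, InnerProductSpace.toDual_apply_apply]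
  field_simp

theorem norm_gradient_gibbsDensity_le (hLip : LipschitzWith K φ) (hε : 0 < ε) (ht : 0 < t)
    {x₀ x : Space d} (hx : ‖x - x₀‖ ≤ 1) (y : Space d) :
    ‖-(gibbsDensity φ ε t x y / (ε * t)) • (x - y)‖ ≤
      Real.exp (1 / (2 * ε * t) - φ x₀ / ε) / (ε * t) *
        Real.exp (-(1 / (4 * ε * t)) * ‖x₀ - y‖ ^ 2 + (K / ε + 1) * ‖x₀ - y‖) := by
  rw [norm_smul, norm_neg, Real.norm_eq_abs,
    abs_of_pos (div_pos (gibbsDensity_pos ..) (by positivity))]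
  have hexp : ‖x - y‖ ≤ Real.exp ‖x₀ - y‖ := by
    linarith [Real.add_one_le_exp ‖x₀ - y‖, norm_sub_le_norm_sub_add_norm_sub x x₀ y]
  calc gibbsDensity φ ε t x y / (ε * t) * ‖x - y‖
      ≤ Real.exp (1 / (2 * ε * t) - φ x₀ / ε) *
        Real.exp (-(1 / (4 * ε * t)) * ‖x₀ - y‖ ^ 2 + K / ε * ‖x₀ - y‖) / (ε * t) *
          Real.exp ‖x₀ - y‖ := by
        gcongr
        exact gibbsDensity_le hLip hε ht hx y
    _ = _ := by
        rw [add_mul, ← add_assoc, Real.exp_add _ (1 * _), one_mul]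
        ring

theorem hasGradientAt_integral_gibbsDensity (hLip : LipschitzWith K φ) (hε : 0 < ε) (ht : 0 < t)
    (x : Space d) :
    HasGradientAt (fun x => ∫ y, gibbsDensity φ ε t x y)
      (∫ y, -(gibbsDensity φ ε t x y / (ε * t)) • (x - y)) x := by
  have hcont (x : Space d) : Continuous (gibbsDensity φ ε t x) :=
    continuous_gibbsDensity hLip.continuous x
  refine hasGradientAt_integral_of_dominated_of_gradient_le
    (G := fun x y => -(gibbsDensity φ ε t x y / (ε * t)) • (x - y)) (Metric.ball_mem_nhds x one_pos)
    (.of_forall fun x' => (hcont x').aestronglyMeasurable) (integrable_gibbsDensity hLip hε ht x)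
    (Continuous.aestronglyMeasurable (by fun_prop))
    (fun y x' hx' => norm_gradient_gibbsDensity_le hLip hε ht (mem_ball_iff_norm.1 hx').le y) ?_
    fun y x' _ => hasGradientAt_gibbsDensity hε ht x' y
  exact ((integrable_exp_neg_mul_sq_norm_add (by positivity) _).comp_sub_left x).const_mul _

theorem hasGradientAt_viscousPotential (hLip : LipschitzWith K φ) (hε : 0 < ε) (ht : 0 < t)
    (x : Space d) :
    HasGradientAt (viscousPotential φ ε t)
      (t⁻¹ • weightedMean volume (gibbsDensity φ ε t x) fun y => x - y) x := by
  have hlog := ((hasGradientAt_integral_gibbsDensity hLip hε ht x).hasFDerivAt.log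
    (integral_gibbsDensity_pos hLip hε ht x).ne').const_mul ε
  have hmean : ∫ y, -(gibbsDensity φ ε t x y / (ε * t)) • (x - y) =
      -(ε * t)⁻¹ • ∫ y, gibbsDensity φ ε t x y • (x - y) := by
    simp only [← integral_smul, smul_smul, neg_mul, div_eq_inv_mul]
  rw [hasGradientAt_iff_hasFDerivAt, funext (viscousPotential_eq hLip hε ht)]
  refine (hlog.const_sub (ε * ((d : ℝ) / 2) * Real.log (2 * Real.pi * ε * t))).congr_fderiv ?_
  rw [hmean, weightedMean]
  ext v
  simp only [neg_smul, map_neg, map_smul, smul_neg, neg_neg, smul_apply,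
    InnerProductSpace.toDual_apply_apply, smul_eq_mul]
  field_simp

theorem differentiable_viscousPotential (hLip : LipschitzWith K φ) (hε : 0 < ε) (ht : 0 < t) :
    Differentiable ℝ (viscousPotential φ ε t) := fun x =>
  (hasGradientAt_viscousPotential hLip hε ht x).differentiableAt

theorem exp_mul_integral_gibbsDensity_le (hLip : LipschitzWith K φ) (hε : 0 < ε) (ht : 0 < t)
    (x x' : Space d) : Real.exp (-(K * ‖x - x'‖ / ε)) * ∫ y, gibbsDensity φ ε t x' y ≤
      ∫ y, gibbsDensity φ ε t x y := by
  rw [← integral_sub_left_eq_self (gibbsDensity φ ε t x) volume x,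
    ← integral_sub_left_eq_self (gibbsDensity φ ε t x') volume x', ← integral_const_mul]
  refine integral_mono (((integrable_gibbsDensity hLip hε ht x').comp_sub_left x').const_mul _)
    ((integrable_gibbsDensity hLip hε ht x).comp_sub_left x) fun z => ?_
  simp only [gibbsDensity, sub_sub_cancel]
  rw [← Real.exp_add, Real.exp_le_exp]
  have hφ : φ (x - z) / ε ≤ φ (x' - z) / ε + K * ‖x - x'‖ / ε := by
    rw [← add_div]
    gcongr
    simpa only [sub_sub_sub_cancel_right] using
      le_add_mul_norm_of_lipschitzWith hLip (x - z) (x' - z)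
  linarith

theorem lipschitzWith_viscousPotential (hLip : LipschitzWith K φ) (hε : 0 < ε) (ht : 0 < t) :
    LipschitzWith K (viscousPotential φ ε t) := by
  refine LipschitzWith.of_le_add_mul K fun x x' => ?_
  have hpos := integral_gibbsDensity_pos hLip hε ht x'
  have hlog := Real.log_le_log (by positivity) (exp_mul_integral_gibbsDensity_le hLip hε ht x x')
  rw [Real.log_mul (Real.exp_pos _).ne' hpos.ne', Real.log_exp] at hlog
  have hmul := mul_le_mul_of_nonneg_left hlog hε.le
  rw [mul_add, mul_neg, mul_div_cancel₀ _ hε.ne'] at hmul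
  rw [viscousPotential_eq hLip hε ht, viscousPotential_eq hLip hε ht, dist_eq_norm]
  linarith

theorem norm_gradient_viscousPotential_le (hLip : LipschitzWith K φ) (hε : 0 < ε) (ht : 0 < t)
    (x : Space d) : ‖gradient (viscousPotential φ ε t) x‖ ≤ K := by
  have h := (differentiable_viscousPotential hLip hε ht x).hasGradientAt.hasFDerivAt.le_of_lipschitz
    (lipschitzWith_viscousPotential hLip hε ht)
  rwa [LinearIsometryEquiv.norm_map] at h

end ColeHopf

section SemiconcavityOfColeHopf

/-- The exponent of the Gibbs density in the variable `z = y - x / (1 + λ t)`, increased by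
`λ_t |x|² / (2 ε)`. By completing the square it splits into a part depending on `z` only and the
composition of the convex function `λ |·|² / 2 - φ` with an affine map. -/
def centredExponent (φ : Space d → ℝ) (lam ε t : ℝ) (x z : Space d) : ℝ :=
  ε⁻¹ * (lam / 2 * ‖z + (1 + lam * t)⁻¹ • x‖ ^ 2 - φ (z + (1 + lam * t)⁻¹ • x) -
    (1 + lam * t) / (2 * t) * ‖z‖ ^ 2)

theorem sq_norm_sub_div_add_eq (ht : 0 < t) (hlam : 0 ≤ lam) (x z : Space d) :
    ‖x - (z + (1 + lam * t)⁻¹ • x)‖ ^ 2 / (2 * t) + lam / 2 * ‖z + (1 + lam * t)⁻¹ • x‖ ^ 2 =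
      (1 + lam * t) / (2 * t) * ‖z‖ ^ 2 + lam / (1 + lam * t) / 2 * ‖x‖ ^ 2 := by
  have : 0 < 1 + lam * t := by positivity
  have hsub : x - (z + (1 + lam * t)⁻¹ • x) = (lam * t / (1 + lam * t)) • x - z := by
    have hcoeff : lam * t / (1 + lam * t) = 1 - (1 + lam * t)⁻¹ := by
      field_simp
      ring
    rw [hcoeff]
    module
  rw [hsub, norm_sub_sq_real, norm_add_sq_real, norm_smul, norm_smul, real_inner_smul_left,
    real_inner_smul_right, mul_pow, mul_pow, Real.norm_eq_abs, Real.norm_eq_abs, sq_abs, sq_abs,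
    real_inner_comm x z]
  field_simp
  ring

theorem exp_centredExponent (hlam : 0 ≤ lam) (hε : 0 < ε) (ht : 0 < t) (x z : Space d) :
    Real.exp (centredExponent φ lam ε t x z) =
      Real.exp (lam / (1 + lam * t) / 2 * ‖x‖ ^ 2 / ε) *
        gibbsDensity φ ε t x (z + (1 + lam * t)⁻¹ • x) := by
  rw [centredExponent, gibbsDensity, ← Real.exp_add,
    ← sub_eq_of_eq_add' (sq_norm_sub_div_add_eq ht hlam x z)]
  congr 1
  field_simp
  ring

theorem convexOn_centredExponent (hconc : LambdaConcave lam φ) (hε : 0 ≤ ε) (z : Space d) :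
    ConvexOn ℝ univ fun x => centredExponent φ lam ε t x z := by
  have hcomp := ((ConcaveOn.translate_right hconc z).comp_linearMap
    ((1 + lam * t)⁻¹ • LinearMap.id)).neg
  refine ((hcomp.add_const (-((1 + lam * t) / (2 * t) * ‖z‖ ^ 2))).smul
    (inv_nonneg.2 hε)).congr fun x _ => ?_
  simp [centredExponent, sub_eq_add_neg]

theorem lambdaConcave_viscousPotential (hlam : 0 ≤ lam) (hLip : LipschitzWith K φ)
    (hconc : LambdaConcave lam φ) (hε : 0 < ε) (ht : 0 < t) :
    LambdaConcave (lam / (1 + lam * t)) (viscousPotential φ ε t) := by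
  have hint (x : Space d) : Integrable fun z => Real.exp (centredExponent φ lam ε t x z) := by
    simp only [exp_centredExponent hlam hε ht]
    exact ((integrable_gibbsDensity hLip hε ht x).comp_add_right _).const_mul _
  have hlog := convexOn_log_integral_exp convex_univ
    (fun z => convexOn_centredExponent (t := t) hconc hε.le z) fun x _ => hint x
  refine ((hlog.smul hε.le).neg.add_const
    (ε * ((d : ℝ) / 2) * Real.log (2 * Real.pi * ε * t))).congr fun x _ => ?_
  simp only [Pi.neg_apply, Pi.add_apply, smul_eq_mul, exp_centredExponent hlam hε ht]
  rw [integral_const_mul, integral_add_right_eq_self (gibbsDensity φ ε t x),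
    Real.log_mul (Real.exp_pos _).ne' (integral_gibbsDensity_pos hLip hε ht x).ne', Real.log_exp,
    viscousPotential_eq hLip hε ht]
  field_simp
  ring

theorem LambdaConcave.mem_differential {mu : ℝ} {f : Space d → ℝ} (hf : LambdaConcave mu f)
    {q x : Space d} (hq : HasGradientAt f q x) : q ∈ differential mu f x := by
  intro z
  have hline : HasDerivAt (AffineMap.lineMap x z : ℝ → Space d) (z - x) 0 :=
    AffineMap.hasDerivAt_lineMap
  have hderiv : HasDerivAt ((fun y => f y - mu / 2 * ‖y‖ ^ 2) ∘ AffineMap.lineMap x z)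
      (inner ℝ q (z - x) - mu * inner ℝ x (z - x)) (0 : ℝ) := by
    have hgrad := hq.hasFDerivAt.sub ((hasFDerivAt_id x).norm_sq.const_mul (mu / 2))
    refine (hgrad.comp_hasDerivAt_of_eq 0 hline (by simp)).congr_deriv ?_
    simp only [id_eq, ContinuousLinearMap.comp_id, sub_apply, InnerProductSpace.toDual_apply_apply,
      smul_apply, coe_innerSL_apply, nsmul_eq_mul, Nat.cast_ofNat, smul_eq_mul]
    ring
  have hconc : ConcaveOn ℝ univ ((fun y => f y - mu / 2 * ‖y‖ ^ 2) ∘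
      (AffineMap.lineMap x z : ℝ → Space d)) := by
    have hcomp := ConcaveOn.comp_affineMap (AffineMap.lineMap x z : ℝ →ᵃ[ℝ] Space d) hf
    rwa [preimage_univ] at hcomp
  have hslope := hconc.slope_le_of_hasDerivAt (mem_univ 0) (mem_univ 1) one_pos hderiv
  simp only [slope_def_field, Function.comp_apply, AffineMap.lineMap_apply_one,
    AffineMap.lineMap_apply_zero, sub_zero, div_one, inner_sub_right x,
    real_inner_self_eq_norm_sq] at hslope
  rw [norm_sub_sq_real, real_inner_comm x z]
  linarith

theorem gradient_viscousPotential_mem_differential (hlam : 0 ≤ lam) (hLip : LipschitzWith K φ)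
    (hconc : LambdaConcave lam φ) (hε : 0 < ε) (ht : 0 < t) (x : Space d) :
    gradient (viscousPotential φ ε t) x ∈
      differential (lam / (1 + lam * t)) (viscousPotential φ ε t) x :=
  (lambdaConcave_viscousPotential hlam hLip hconc hε ht).mem_differential
    (differentiable_viscousPotential hLip hε ht x).hasGradientAt

end SemiconcavityOfColeHopf

theorem weightedMean_comp_sub_smul {V E : Type*} [NormedAddCommGroup V] [NormedSpace ℝ V]
    [FiniteDimensional ℝ V] [MeasurableSpace V] [BorelSpace V] {μ : Measure V} [μ.IsAddHaarMeasure]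
    [NormedAddCommGroup E] [NormedSpace ℝ E] {s : ℝ} (hs : s ≠ 0) (w : V → ℝ) (g : V → E) (x : V) :
    weightedMean μ (fun z => w (x - s • z)) (fun z => g (x - s • z)) = weightedMean μ w g := by
  rw [weightedMean, weightedMean, Measure.integral_comp_smul μ (fun z => w (x - z)),
    Measure.integral_comp_smul μ (fun z => w (x - z) • g (x - z)),
    integral_sub_left_eq_self w μ x, integral_sub_left_eq_self (fun z => w z • g z) μ x,
    smul_eq_mul, mul_inv, mul_smul, smul_comm _ |_|, inv_smul_smul₀]
  exact abs_ne_zero.2 (inv_ne_zero (pow_ne_zero _ hs))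

theorem exp_add_mul_mul_add_le {r M : ℝ} (hr : 0 ≤ r) (hM : 0 ≤ M) (b c : ℝ) :
    Real.exp (c + b * r) * (r + M) ≤ (1 + M) * Real.exp (c + (b + 1) * r) := by
  have hexp : r + M ≤ (1 + M) * Real.exp r := by
    nlinarith [Real.add_one_le_exp r, Real.one_le_exp hr]
  calc Real.exp (c + b * r) * (r + M) ≤ Real.exp (c + b * r) * ((1 + M) * Real.exp r) := by gcongr
    _ = (1 + M) * Real.exp (c + (b + 1) * r) := by
      rw [mul_left_comm, ← Real.exp_add]
      ring_nf

section ScaledMean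

/-- The Gibbs density at time `s ^ 2` in the variable `ζ = (x - y) / s`, normalized to have bounds
in `ζ` that are uniform in `x`; unlike the gradient of the Cole-Hopf potential, it is regular up
to `s = 0`. -/
def scaledDensity (φ : Space d → ℝ) (ε s : ℝ) (x ζ : Space d) : ℝ :=
  Real.exp (-(1 / (2 * ε)) * ‖ζ‖ ^ 2 + (φ x - φ (x - s • ζ)) / ε)

/-- The mean of the probability measure with density proportional to `scaledDensity`; the velocity
at time `s ^ 2` of the viscous flow is `s⁻¹ • scaledMean φ ε s`. -/
def scaledMean (φ : Space d → ℝ) (ε s : ℝ) (x : Space d) : Space d :=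
  weightedMean volume (scaledDensity φ ε s x) id

theorem gibbsDensity_sub_smul (φ : Space d → ℝ) {s : ℝ} (hε : 0 < ε) (hs : 0 < s)
    (x ζ : Space d) : gibbsDensity φ ε (s ^ 2) x (x - s • ζ) =
      Real.exp (-φ x / ε) * scaledDensity φ ε s x ζ := by
  rw [gibbsDensity, scaledDensity, ← Real.exp_add, sub_sub_cancel, norm_smul, mul_pow,
    Real.norm_eq_abs, sq_abs]
  congr 1
  field_simp
  ring

theorem gradient_viscousPotential_sq (hLip : LipschitzWith K φ) (hε : 0 < ε) {s : ℝ} (hs : 0 < s)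
    (x : Space d) : gradient (viscousPotential φ ε (s ^ 2)) x = s⁻¹ • scaledMean φ ε s x := by
  have hmean : weightedMean volume (gibbsDensity φ ε (s ^ 2) x) (fun y => x - y) =
      s • scaledMean φ ε s x := by
    rw [← weightedMean_comp_sub_smul hs.ne' _ _ x]
    simp only [gibbsDensity_sub_smul φ hε hs, sub_sub_cancel]
    rw [weightedMean_const_mul (Real.exp_pos _).ne', weightedMean_const_smul]
    rfl
  rw [(hasGradientAt_viscousPotential hLip hε (pow_pos hs 2) x).gradient, hmean, smul_smul, sq,
    mul_inv, mul_assoc, inv_mul_cancel₀ hs.ne', mul_one]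

variable {s s' S : ℝ}

theorem abs_div_sub_comp_le (hLip : LipschitzWith K φ) (hε : 0 < ε) (hs : s ∈ Icc 0 S)
    (x ζ : Space d) : |(φ x - φ (x - s • ζ)) / ε| ≤ K * S / ε * ‖ζ‖ := by
  have h := hLip.dist_le_mul x (x - s • ζ)
  rw [Real.dist_eq, dist_eq_norm, sub_sub_cancel, norm_smul, Real.norm_eq_abs,
    abs_of_nonneg hs.1] at h
  rw [abs_div, abs_of_pos hε, div_mul_eq_mul_div, mul_assoc]
  gcongr
  refine h.trans ?_
  gcongr
  exact hs.2

theorem scaledDensity_pos (φ : Space d → ℝ) (ε s : ℝ) (x ζ : Space d) :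
    0 < scaledDensity φ ε s x ζ := Real.exp_pos _

theorem scaledDensity_le (hLip : LipschitzWith K φ) (hε : 0 < ε) (hs : s ∈ Icc 0 S)
    (x ζ : Space d) :
    scaledDensity φ ε s x ζ ≤ Real.exp (-(1 / (2 * ε)) * ‖ζ‖ ^ 2 + K * S / ε * ‖ζ‖) := by
  rw [scaledDensity]
  gcongr
  exact (abs_le.1 (abs_div_sub_comp_le hLip hε hs x ζ)).2

theorem le_scaledDensity (hLip : LipschitzWith K φ) (hε : 0 < ε) (hs : s ∈ Icc 0 S)
    (x ζ : Space d) :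
    Real.exp (-(1 / (2 * ε)) * ‖ζ‖ ^ 2 + -(K * S / ε) * ‖ζ‖) ≤ scaledDensity φ ε s x ζ := by
  rw [scaledDensity, neg_mul (K * S / ε)]
  gcongr
  exact (abs_le.1 (abs_div_sub_comp_le hLip hε hs x ζ)).1

theorem continuous_scaledDensity (hφ : Continuous φ) (s : ℝ) (x : Space d) :
    Continuous (scaledDensity φ ε s x) := by
  unfold scaledDensity
  fun_prop

theorem integrable_scaledDensity (hLip : LipschitzWith K φ) (hε : 0 < ε) (hs : s ∈ Icc 0 S)
    (x : Space d) : Integrable (scaledDensity φ ε s x) := by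
  refine (integrable_exp_neg_mul_sq_norm_add (a := 1 / (2 * ε)) (by positivity) (K * S / ε)).mono'
    (continuous_scaledDensity hLip.continuous s x).aestronglyMeasurable (ae_of_all _ fun ζ => ?_)
  rw [Real.norm_eq_abs, abs_of_pos (scaledDensity_pos ..)]
  exact scaledDensity_le hLip hε hs x ζ

theorem norm_scaledDensity_smul_le (hLip : LipschitzWith K φ) (hε : 0 < ε) (hs : s ∈ Icc 0 S)
    (x ζ : Space d) : ‖scaledDensity φ ε s x ζ • id ζ‖ ≤
      Real.exp (-(1 / (2 * ε)) * ‖ζ‖ ^ 2 + (K * S / ε + 1) * ‖ζ‖) := by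
  have h := exp_add_mul_mul_add_le (norm_nonneg ζ) le_rfl (K * S / ε) (-(1 / (2 * ε)) * ‖ζ‖ ^ 2)
  rw [add_zero, add_zero, one_mul] at h
  rw [norm_smul, Real.norm_eq_abs, abs_of_pos (scaledDensity_pos ..)]
  refine h.trans' ?_
  gcongr
  · exact scaledDensity_le hLip hε hs x ζ
  · exact le_rfl

theorem integrable_scaledDensity_smul (hLip : LipschitzWith K φ) (hε : 0 < ε) (hs : s ∈ Icc 0 S)
    (x : Space d) : Integrable fun ζ => scaledDensity φ ε s x ζ • id ζ :=
  (integrable_exp_neg_mul_sq_norm_add (by positivity) _).mono'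
    ((continuous_scaledDensity hLip.continuous s x).smul continuous_id).aestronglyMeasurable
    (ae_of_all _ (norm_scaledDensity_smul_le hLip hε hs x))

theorem abs_scaledDensity_sub_le (hLip : LipschitzWith K φ) (hε : 0 < ε) (hs : s ∈ Icc 0 S)
    (hs' : s' ∈ Icc 0 S) (x x' ζ : Space d) :
    |scaledDensity φ ε s x ζ - scaledDensity φ ε s' x' ζ| ≤
      K / ε * (2 * ‖x - x'‖ + |s - s'| * ‖ζ‖) *
        Real.exp (-(1 / (2 * ε)) * ‖ζ‖ ^ 2 + K * S / ε * ‖ζ‖) := by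
  refine (abs_exp_sub_exp_le
    (add_le_add_right (abs_le.1 (abs_div_sub_comp_le hLip hε hs x ζ)).2 _)
    (add_le_add_right (abs_le.1 (abs_div_sub_comp_le hLip hε hs' x' ζ)).2 _)).trans ?_
  gcongr
  have hx : |φ x - φ x'| ≤ K * ‖x - x'‖ := hLip.norm_sub_le x x'
  have hxζ : |φ (x - s • ζ) - φ (x' - s' • ζ)| ≤ K * (‖x - x'‖ + |s - s'| * ‖ζ‖) := by
    refine (hLip.norm_sub_le _ _).trans ?_
    gcongr
    rw [sub_sub_sub_comm, ← sub_smul, ← Real.norm_eq_abs, ← norm_smul]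
    exact norm_sub_le _ _
  rw [add_sub_add_left_eq_sub, ← sub_div, sub_sub_sub_comm, abs_div, abs_of_pos hε,
    div_mul_eq_mul_div]
  gcongr
  linarith [abs_sub (φ x - φ x') (φ (x - s • ζ) - φ (x' - s' • ζ))]

theorem abs_scaledDensity_sub_mul_le (hLip : LipschitzWith K φ) (hε : 0 < ε) (hs : s ∈ Icc 0 S)
    (hs' : s' ∈ Icc 0 S) {x x' : Space d} {D M : ℝ} (hx : ‖x - x'‖ ≤ D) (hsD : |s - s'| ≤ D)
    (hM : 0 ≤ M) (ζ : Space d) :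
    |scaledDensity φ ε s x ζ - scaledDensity φ ε s' x' ζ| * (‖ζ‖ + M) ≤ D * (4 * K / ε * (1 + M) *
      Real.exp (-(1 / (2 * ε)) * ‖ζ‖ ^ 2 + (K * S / ε + 1 + 1) * ‖ζ‖)) := by
  have hD : 0 ≤ D := (norm_nonneg _).trans hx
  set c := -(1 / (2 * ε)) * ‖ζ‖ ^ 2
  set b := K * S / ε
  calc |scaledDensity φ ε s x ζ - scaledDensity φ ε s' x' ζ| * (‖ζ‖ + M)
      ≤ K / ε * (2 * ‖x - x'‖ + |s - s'| * ‖ζ‖) * Real.exp (c + b * ‖ζ‖) * (‖ζ‖ + M) := by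
        gcongr
        exact abs_scaledDensity_sub_le hLip hε hs hs' x x' ζ
    _ ≤ K / ε * (2 * D + 2 * D * ‖ζ‖) * Real.exp (c + b * ‖ζ‖) * (‖ζ‖ + M) := by
        gcongr
        linarith
    _ = K / ε * (2 * D) * (Real.exp (c + b * ‖ζ‖) * (‖ζ‖ + 1)) * (‖ζ‖ + M) := by ring
    _ ≤ K / ε * (2 * D) * ((1 + 1) * Real.exp (c + (b + 1) * ‖ζ‖)) * (‖ζ‖ + M) := by
        gcongr K / ε * (2 * D) * ?_ * (‖ζ‖ + M)
        exact exp_add_mul_mul_add_le (norm_nonneg ζ) zero_le_one b c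
    _ = 4 * K / ε * D * (Real.exp (c + (b + 1) * ‖ζ‖) * (‖ζ‖ + M)) := by ring
    _ ≤ 4 * K / ε * D * ((1 + M) * Real.exp (c + (b + 1 + 1) * ‖ζ‖)) := by
        gcongr 4 * K / ε * D * ?_
        exact exp_add_mul_mul_add_le (norm_nonneg ζ) hM (b + 1) c
    _ = D * (4 * K / ε * (1 + M) * Real.exp (c + (b + 1 + 1) * ‖ζ‖)) := by ring

theorem exists_norm_scaledMean_le (hLip : LipschitzWith K φ) (hε : 0 < ε) (S : ℝ) :
    ∃ M : ℝ≥0, ∀ s ∈ Icc 0 S, ∀ x, ‖scaledMean φ ε s x‖ ≤ M := by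
  have hint (b : ℝ) : Integrable fun ζ : Space d =>
      Real.exp (-(1 / (2 * ε)) * ‖ζ‖ ^ 2 + b * ‖ζ‖) :=
    integrable_exp_neg_mul_sq_norm_add (by positivity) b
  refine ⟨Real.toNNReal _, fun s hs x => (norm_weightedMean_le (integral_exp_pos (hint _))
    (integral_mono (hint _) (integrable_scaledDensity hLip hε hs x) (le_scaledDensity hLip hε hs x))
    (hint _) (norm_scaledDensity_smul_le hLip hε hs x)).trans (Real.le_coe_toNNReal _)⟩

theorem exists_lipschitzOnWith_scaledMean (hLip : LipschitzWith K φ) (hε : 0 < ε) (S : ℝ) :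
    ∃ C : ℝ≥0, LipschitzOnWith C (fun p : ℝ × Space d => scaledMean φ ε p.1 p.2)
      (Icc 0 S ×ˢ univ) := by
  obtain ⟨M, hM⟩ := exists_norm_scaledMean_le hLip hε S
  have hint (b : ℝ) : Integrable fun ζ : Space d =>
      Real.exp (-(1 / (2 * ε)) * ‖ζ‖ ^ 2 + b * ‖ζ‖) :=
    integrable_exp_neg_mul_sq_norm_add (by positivity) b
  set m := ∫ ζ : Space d, Real.exp (-(1 / (2 * ε)) * ‖ζ‖ ^ 2 + -(K * S / ε) * ‖ζ‖)
  set k : Space d → ℝ := fun ζ => 4 * K / ε * (1 + M) *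
    Real.exp (-(1 / (2 * ε)) * ‖ζ‖ ^ 2 + (K * S / ε + 1 + 1) * ‖ζ‖)
  refine ⟨(m⁻¹ * ∫ ζ, k ζ).toNNReal, .of_dist_le_mul fun p hp p' hp' => ?_⟩
  rw [dist_eq_norm]
  have hle {s : ℝ} (hs : s ∈ Icc 0 S) (x : Space d) : m ≤ ∫ ζ, scaledDensity φ ε s x ζ :=
    integral_mono (hint _) (integrable_scaledDensity hLip hε hs x) (le_scaledDensity hLip hε hs x)
  have hdom (ζ : Space d) : |scaledDensity φ ε p.1 p.2 ζ - scaledDensity φ ε p'.1 p'.2 ζ| *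
      (‖id ζ‖ + ‖scaledMean φ ε p'.1 p'.2‖) ≤ dist p p' * k ζ := by
    refine (abs_scaledDensity_sub_mul_le hLip hε hp.1 hp'.1 ((dist_eq_norm _ _).symm.trans_le
      (le_max_right _ _)) (le_max_left _ _) M.coe_nonneg ζ).trans' ?_
    gcongr
    exacts [le_rfl, hM _ hp'.1 _]
  have h := norm_weightedMean_sub_le (integral_exp_pos (hint _)) (hle hp.1 p.2)
    ((integral_exp_pos (hint _)).trans_le (hle hp'.1 p'.2)).ne'
    (integrable_scaledDensity hLip hε hp.1 p.2) (integrable_scaledDensity hLip hε hp'.1 p'.2)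
    (integrable_scaledDensity_smul hLip hε hp.1 p.2)
    (integrable_scaledDensity_smul hLip hε hp'.1 p'.2)
    (((hint _).const_mul _).const_mul (dist p p')) hdom
  rw [integral_const_mul, mul_left_comm, mul_comm (dist p p')] at h
  exact h.trans (by gcongr; exact Real.le_coe_toNNReal _)

end ScaledMean

section HopfLax

theorem bddBelow_range_hopfLax (hLip : LipschitzWith K φ) (ht : 0 < t) (x : Space d) :
    BddBelow (range fun y : Space d => ‖x - y‖ ^ 2 / (2 * t) + φ y) := by
  refine ⟨φ x - K ^ 2 * t / 2, forall_mem_range.2 fun y => ?_⟩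
  have hsq : ‖x - y‖ ^ 2 / (2 * t) - K * ‖x - y‖ + K ^ 2 * t / 2 =
      (‖x - y‖ - K * t) ^ 2 / (2 * t) := by
    field_simp
    ring
  have hpos : 0 ≤ (‖x - y‖ - K * t) ^ 2 / (2 * t) := by positivity
  linarith [le_add_mul_norm_of_lipschitzWith hLip x y]

theorem hopfLax_le (hLip : LipschitzWith K φ) (ht : 0 < t) (x y : Space d) :
    hopfLax φ t x ≤ ‖x - y‖ ^ 2 / (2 * t) + φ y :=
  ciInf_le (bddBelow_range_hopfLax hLip ht x) y

theorem lipschitzWith_hopfLax (hLip : LipschitzWith K φ) (ht : 0 < t) :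
    LipschitzWith K (hopfLax φ t) := by
  refine LipschitzWith.of_le_add_mul K fun x x' => ?_
  rw [← sub_le_iff_le_add, dist_eq_norm]
  refine le_ciInf fun y => ?_
  have hle := hopfLax_le hLip ht x (y + (x - x'))
  have hφ := le_add_mul_norm_of_lipschitzWith hLip (y + (x - x')) y
  rw [show x - (y + (x - x')) = x' - y by abel] at hle
  rw [add_sub_cancel_left] at hφ
  linarith

theorem antitoneOn_hopfLax (hLip : LipschitzWith K φ) (x : Space d) :
    AntitoneOn (fun t => hopfLax φ t x) (Ioi 0) := fun s hs t ht hst => by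
  refine le_ciInf fun y => (hopfLax_le hLip ht x y).trans ?_
  have := mem_Ioi.1 hs
  gcongr

-- Compares a competitor `y` at time `t` with the point dividing `[x, y]` in the ratio `s : t - s`.
theorem hopfLax_le_hopfLax_add (hLip : LipschitzWith K φ) {s : ℝ} (hs : 0 < s) (hst : s ≤ t)
    (x : Space d) : hopfLax φ s x ≤ hopfLax φ t x + K ^ 2 / 2 * (t - s) := by
  have ht : 0 < t := hs.trans_le hst
  rw [← sub_le_iff_le_add]
  refine le_ciInf fun y => ?_
  have hle := hopfLax_le hLip hs x (x - (s / t) • (x - y))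
  have hφ := le_add_mul_norm_of_lipschitzWith hLip (x - (s / t) • (x - y)) y
  rw [show x - (s / t) • (x - y) - y = (1 - s / t) • (x - y) by module, norm_smul,
    Real.norm_of_nonneg (sub_nonneg.2 ((div_le_one ht).2 hst))] at hφ
  rw [sub_sub_cancel, norm_smul, Real.norm_of_nonneg (by positivity)] at hle
  have hsq : ‖x - y‖ ^ 2 / (2 * t) - (s / t * ‖x - y‖) ^ 2 / (2 * s) -
      K * ((1 - s / t) * ‖x - y‖) + K ^ 2 / 2 * (t - s) =
      (t - s) * (‖x - y‖ / t - K) ^ 2 / 2 := by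
    field_simp
    ring
  have hpos : 0 ≤ (t - s) * (‖x - y‖ / t - K) ^ 2 / 2 := by
    have := sub_nonneg.2 hst
    positivity
  linarith

theorem lipschitzOnWith_hopfLax (hLip : LipschitzWith K φ) (x : Space d) :
    LipschitzOnWith (K ^ 2 / 2) (fun t => hopfLax φ t x) (Ioi 0) := by
  refine LipschitzOnWith.of_le_add_mul _ fun s hs t ht => ?_
  rw [Real.dist_eq, NNReal.coe_div, NNReal.coe_pow, NNReal.coe_ofNat]
  rcases le_total s t with hst | hts
  · rw [abs_sub_comm, abs_of_nonneg (sub_nonneg.2 hst)]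
    exact hopfLax_le_hopfLax_add hLip hs hst x
  · exact (antitoneOn_hopfLax hLip x ht hs hts).trans (le_add_of_nonneg_right (by positivity))

theorem continuousOn_hopfLax (hLip : LipschitzWith K φ) :
    ContinuousOn (fun p : ℝ × Space d => hopfLax φ p.1 p.2) (Ioi 0 ×ˢ univ) :=
  continuousOn_prod_of_continuousOn_lipschitzOnWith' _ K
    (fun _ ht => (lipschitzWith_hopfLax hLip ht).lipschitzOnWith)
    fun x _ => (lipschitzOnWith_hopfLax hLip x).continuousOn

end HopfLax

section ViscousApproximation

theorem sub_mul_log_gaussian_eq (hε : 0 < ε) (ht : 0 < t) {b : ℝ} (hb : 0 < b) (c : ℝ) :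
    ε * ((d : ℝ) / 2) * Real.log (2 * Real.pi * ε * t) -
      ε * Real.log (Real.exp (-c / ε) * (Real.pi / b) ^ ((d : ℝ) / 2)) =
      c + ε * ((d : ℝ) / 2) * Real.log (2 * ε * t * b) := by
  have hprod : 2 * Real.pi * ε * t = 2 * ε * t * b * (Real.pi / b) := by field_simp
  rw [hprod, Real.log_mul (x := 2 * ε * t * b) (by positivity) (by positivity),
    Real.log_mul (x := Real.exp _) (by positivity) (by positivity), Real.log_exp,
    Real.log_rpow (by positivity)]
  field_simp
  ring

theorem viscousPotential_le_of_le_integral (hLip : LipschitzWith K φ) (hε : 0 < ε) (ht : 0 < t)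
    {b c : ℝ} (hb : 0 < b) {x : Space d}
    (h : Real.exp (-c / ε) * (Real.pi / b) ^ ((d : ℝ) / 2) ≤ ∫ y, gibbsDensity φ ε t x y) :
    viscousPotential φ ε t x ≤ c + ε * ((d : ℝ) / 2) * Real.log (2 * ε * t * b) := by
  rw [viscousPotential_eq hLip hε ht, ← sub_mul_log_gaussian_eq hε ht hb]
  gcongr

theorem le_viscousPotential_of_integral_le (hLip : LipschitzWith K φ) (hε : 0 < ε) (ht : 0 < t)
    {b c : ℝ} (hb : 0 < b) {x : Space d}
    (h : ∫ y, gibbsDensity φ ε t x y ≤ Real.exp (-c / ε) * (Real.pi / b) ^ ((d : ℝ) / 2)) :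
    c + ε * ((d : ℝ) / 2) * Real.log (2 * ε * t * b) ≤ viscousPotential φ ε t x := by
  rw [viscousPotential_eq hLip hε ht, ← sub_mul_log_gaussian_eq hε ht hb]
  have := integral_gibbsDensity_pos hLip hε ht x
  gcongr

theorem exp_le_gibbsDensity_add (hLip : LipschitzWith K φ) (hε : 0 < ε) (ht : 0 < t)
    (x y z : Space d) :
    Real.exp (-(‖x - y‖ ^ 2 / (2 * t) + φ y + ε * (K ^ 2 / 2)) / ε) *
        Real.exp (-((ε + t) / (2 * ε ^ 2 * t)) * ‖z‖ ^ 2 + inner ℝ ((ε * t)⁻¹ • (x - y)) z) ≤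
      gibbsDensity φ ε t x (z + y) := by
  rw [gibbsDensity, ← Real.exp_add, Real.exp_le_exp]
  have hφ : φ (z + y) ≤ φ y + (‖z‖ ^ 2 / (2 * ε) + K ^ 2 * ε / 2) := by
    have hsq : ‖z‖ ^ 2 / (2 * ε) + K ^ 2 * ε / 2 - K * ‖z‖ = (‖z‖ - K * ε) ^ 2 / (2 * ε) := by
      field_simp
      ring
    have hpos : 0 ≤ (‖z‖ - K * ε) ^ 2 / (2 * ε) := by positivity
    have hz := le_add_mul_norm_of_lipschitzWith hLip (z + y) y
    rw [add_sub_cancel_right] at hz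
    linarith
  calc _ = -‖x - (z + y)‖ ^ 2 / (2 * ε * t) - (φ y + (‖z‖ ^ 2 / (2 * ε) + K ^ 2 * ε / 2)) / ε := by
        rw [add_comm z, ← sub_sub, norm_sub_sq_real (x - y) z, real_inner_smul_left]
        field_simp
        ring
    _ ≤ _ := by gcongr

theorem viscousPotential_le (hLip : LipschitzWith K φ) (hε : 0 < ε) (ht : 0 < t) (x : Space d) :
    viscousPotential φ ε t x ≤ hopfLax φ t x +
      (ε * (K ^ 2 / 2) + ε * ((d : ℝ) / 2) * Real.log ((ε + t) / ε)) := by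
  rw [← sub_le_iff_le_add]
  refine le_ciInf fun y => ?_
  set b := (ε + t) / (2 * ε ^ 2 * t) with hb
  have hb0 : 0 < b := by positivity
  have hint : Real.exp (-(‖x - y‖ ^ 2 / (2 * t) + φ y + ε * (K ^ 2 / 2)) / ε) *
      (Real.pi / b) ^ ((d : ℝ) / 2) ≤ ∫ z, gibbsDensity φ ε t x z := by
    have hgauss := integral_exp_neg_mul_sq_norm_le_add_inner hb0 ((ε * t)⁻¹ • (x - y))
    rw [finrank_euclideanSpace_fin] at hgauss
    refine (mul_le_mul_of_nonneg_left hgauss (Real.exp_nonneg _)).trans ?_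
    rw [← integral_const_mul, ← integral_add_right_eq_self (gibbsDensity φ ε t x) y]
    exact integral_mono ((integrable_exp_neg_mul_sq_norm_add_inner hb0 _).const_mul _)
      ((integrable_gibbsDensity hLip hε ht x).comp_add_right y)
      (exp_le_gibbsDensity_add hLip hε ht x y)
  have hu := viscousPotential_le_of_le_integral hLip hε ht hb0 hint
  rw [show 2 * ε * t * b = (ε + t) / ε by rw [hb]; field_simp] at hu
  linarith

theorem gibbsDensity_sub_le (hLip : LipschitzWith K φ) (hε : 0 < ε) (hε1 : ε < 1) (ht : 0 < t)
    (x z : Space d) : gibbsDensity φ ε t x (x - z) ≤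
      Real.exp (-hopfLax φ (t / (1 - ε)) x / ε) * Real.exp (-(1 / (2 * t)) * ‖z‖ ^ 2) := by
  have hε' : 0 < 1 - ε := sub_pos.2 hε1
  rw [gibbsDensity, ← Real.exp_add, Real.exp_le_exp, sub_sub_cancel]
  have hle := hopfLax_le hLip (div_pos ht hε') x (x - z)
  rw [sub_sub_cancel] at hle
  calc -‖z‖ ^ 2 / (2 * ε * t) - φ (x - z) / ε
      = -(‖z‖ ^ 2 / (2 * (t / (1 - ε))) + φ (x - z)) / ε + -(1 / (2 * t)) * ‖z‖ ^ 2 := by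
        field_simp
        ring
    _ ≤ -hopfLax φ (t / (1 - ε)) x / ε + -(1 / (2 * t)) * ‖z‖ ^ 2 := by gcongr

theorem le_viscousPotential (hLip : LipschitzWith K φ) (hε : 0 < ε) (hε1 : ε < 1) (ht : 0 < t)
    (x : Space d) : hopfLax φ (t / (1 - ε)) x + ε * ((d : ℝ) / 2) * Real.log ε ≤
      viscousPotential φ ε t x := by
  have hb : 0 < 1 / (2 * t) := by positivity
  have hint : ∫ y, gibbsDensity φ ε t x y ≤ Real.exp (-hopfLax φ (t / (1 - ε)) x / ε) *
      (Real.pi / (1 / (2 * t))) ^ ((d : ℝ) / 2) := by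
    have hgauss := GaussianFourier.integral_rexp_neg_mul_sq_norm (V := Space d) hb
    rw [finrank_euclideanSpace_fin] at hgauss
    rw [← hgauss, ← integral_const_mul, ← integral_sub_left_eq_self _ volume x]
    exact integral_mono ((integrable_gibbsDensity hLip hε ht x).comp_sub_left x)
      ((integrable_exp_neg_mul_sq_norm hb).const_mul _) (gibbsDensity_sub_le hLip hε hε1 ht x)
  have hu := le_viscousPotential_of_integral_le hLip hε ht hb hint
  rwa [show 2 * ε * t * (1 / (2 * t)) = ε by field_simp] at hu

theorem hopfLax_sub_viscousPotential_le (hLip : LipschitzWith K φ) (hε : 0 < ε) (hε1 : ε < 1)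
    (ht : 0 < t) (x : Space d) : hopfLax φ t x - viscousPotential φ ε t x ≤
      K ^ 2 / 2 * (t * ((1 - ε)⁻¹ - 1)) - ε * ((d : ℝ) / 2) * Real.log ε := by
  have hmono := hopfLax_le_hopfLax_add hLip ht (le_div_self ht.le (sub_pos.2 hε1) (by linarith)) x
  have hle := le_viscousPotential hLip hε hε1 ht x
  rw [div_eq_mul_inv] at hmono hle
  linarith

theorem tendsto_mul_log_add_div {T : ℝ} (hT : 0 < T) :
    Tendsto (fun ε => ε * Real.log ((ε + T) / ε)) (𝓝[>] 0) (𝓝 0) := by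
  have hcont : ContinuousAt (fun ε => ε * Real.log (ε + T) - ε * Real.log ε) 0 :=
    (continuousAt_id.mul ((continuousAt_id.add continuousAt_const).log
      (by simpa using hT.ne'))).sub Real.continuous_mul_log.continuousAt
  have hlim := tendsto_nhdsWithin_of_tendsto_nhds (s := Ioi 0) hcont.tendsto
  simp only [zero_mul, sub_zero] at hlim
  refine hlim.congr' (eventually_mem_nhdsWithin.mono fun ε (hε : 0 < ε) => ?_)
  simp only [Real.log_div (add_pos hε hT).ne' hε.ne', mul_sub]

theorem tendstoUniformlyOn_viscousPotential (hLip : LipschitzWith K φ) {T : ℝ} (hT : 0 < T) :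
    TendstoUniformlyOn (fun ε p => viscousPotential φ ε p.1 p.2)
      (fun p : ℝ × Space d => hopfLax φ p.1 p.2) (𝓝[>] 0) (Ioc 0 T ×ˢ univ) := by
  rw [Metric.tendstoUniformlyOn_iff]
  intro η hη
  have hlog : Tendsto (fun ε => ε * Real.log ε) (𝓝[>] 0) (𝓝 0) := by
    simpa using tendsto_nhdsWithin_of_tendsto_nhds (s := Ioi 0) (Real.continuous_mul_log.tendsto 0)
  have hid : Tendsto (fun ε : ℝ => ε) (𝓝[>] 0) (𝓝 0) :=
    tendsto_nhdsWithin_of_tendsto_nhds tendsto_id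
  have hupper : Tendsto (fun ε => ε * (K ^ 2 / 2) + d / 2 * (ε * Real.log ((ε + T) / ε)))
      (𝓝[>] 0) (𝓝 0) := by
    simpa using (hid.mul_const _).add ((tendsto_mul_log_add_div hT).const_mul ((d : ℝ) / 2))
  have hlower : Tendsto (fun ε => K ^ 2 / 2 * (T * ((1 - ε)⁻¹ - 1)) - d / 2 * (ε * Real.log ε))
      (𝓝[>] 0) (𝓝 0) := by
    have hinv := ((hid.const_sub 1).inv₀ (by simp)).sub_const 1
    simpa using ((hinv.const_mul T).const_mul ((K : ℝ) ^ 2 / 2)).sub (hlog.const_mul ((d : ℝ) / 2))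
  filter_upwards [hupper.eventually_lt_const hη, hlower.eventually_lt_const hη,
    self_mem_nhdsWithin, mem_nhdsWithin_of_mem_nhds (Iio_mem_nhds one_pos)]
    with ε hεu hεl (hε : 0 < ε) (hε1 : ε < 1) ⟨t, x⟩ ⟨⟨ht, htT⟩, _⟩
  have hupperT : ε * ((d : ℝ) / 2) * Real.log ((ε + t) / ε) ≤
      ε * ((d : ℝ) / 2) * Real.log ((ε + T) / ε) := by gcongr
  have hlowerT : (K : ℝ) ^ 2 / 2 * (t * ((1 - ε)⁻¹ - 1)) ≤ K ^ 2 / 2 * (T * ((1 - ε)⁻¹ - 1)) := by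
    have := sub_nonneg.2 ((one_le_inv₀ (sub_pos.2 hε1)).2 (sub_le_self 1 hε.le))
    gcongr
  have := viscousPotential_le hLip hε ht x
  have := hopfLax_sub_viscousPotential_le hLip hε hε1 ht x
  rw [Real.dist_eq, abs_lt]
  constructor <;> linarith

end ViscousApproximation

section Stability

/-- `x` is a Lipschitz solution on `[a, b]` of the differential inclusion `x' ∈ ∂f_t(x)`, where the
potential `f_t` is thought of as `lam / (1 + lam * t)`-concave. It covers both the viscous and the
inviscid paths, so that the two can be compared. -/
structure IsInclusionSolutionOn (f : ℝ → Space d → ℝ) (lam a b : ℝ) (x : ℝ → Space d) : Prop where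
  lipschitz : ∃ L : ℝ≥0, LipschitzOnWith L x (Icc a b)
  inclusion : ∀ᵐ t, t ∈ Ioo a b →
    ∃ v ∈ differential (lam / (1 + lam * t)) (f t) (x t), HasDerivAt x v t

theorem inner_sub_le_of_mem_differential {mu δ : ℝ} {f g : Space d → ℝ}
    (hfg : ∀ z, |f z - g z| ≤ δ) {x y p q : Space d} (hp : p ∈ differential mu f x)
    (hq : q ∈ differential mu g y) : inner ℝ (x - y) (p - q) ≤ mu * ‖x - y‖ ^ 2 + 2 * δ := by
  have hpy := hp y
  have hqx := hq x
  rw [norm_sub_rev y x, ← neg_sub x y, inner_neg_right, real_inner_comm] at hpy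
  rw [real_inner_comm] at hqx
  rw [inner_sub_right]
  linarith [(abs_le.1 (hfg x)).2, (abs_le.1 (hfg y)).1]

theorem deriv_sq_norm_sub_div_le (hlam : 0 ≤ lam) (ht : 0 ≤ t) {δ : ℝ} {f g : Space d → ℝ}
    (hfg : ∀ z, |f z - g z| ≤ δ) {x y : ℝ → Space d} {p q : Space d}
    (hp : p ∈ differential (lam / (1 + lam * t)) f (x t))
    (hq : q ∈ differential (lam / (1 + lam * t)) g (y t)) (hx : HasDerivAt x p t)
    (hy : HasDerivAt y q t) :
    deriv (fun t => ‖x t - y t‖ ^ 2 / (1 + lam * t) ^ 2) t ≤ 4 * δ := by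
  have : 0 < 1 + lam * t := by positivity
  have hδ : 0 ≤ δ := (abs_nonneg _).trans (hfg 0)
  have hinner := inner_sub_le_of_mem_differential hfg hp hq
  have hden : HasDerivAt (fun t => (1 + lam * t) ^ 2) (2 * (1 + lam * t) * lam) t := by
    simpa using (((hasDerivAt_id t).const_mul lam).const_add 1).fun_pow 2
  have hderiv : HasDerivAt (fun t => ‖x t - y t‖ ^ 2 / (1 + lam * t) ^ 2) _ t :=
    (hx.sub hy).norm_sq.fun_div hden (by positivity)
  rw [hderiv.deriv]
  calc _ = 2 * (inner ℝ (x t - y t) (p - q) - lam / (1 + lam * t) * ‖x t - y t‖ ^ 2) /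
          (1 + lam * t) ^ 2 := by
        simp only [Pi.sub_apply]
        field_simp
    _ ≤ 2 * (2 * δ) / (1 + lam * t) ^ 2 := by
        gcongr
        linarith
    _ ≤ 4 * δ := by
        rw [← mul_assoc]
        exact (div_le_self (by positivity)
          (one_le_pow₀ (le_add_of_nonneg_right (by positivity)))).trans_eq (by ring)

theorem absolutelyContinuousOnInterval_sq_norm_sub_div (hlam : 0 ≤ lam) {a b : ℝ} (ha : 0 ≤ a)
    (hab : a ≤ b) {x y : ℝ → Space d} {Lx Ly : ℝ≥0} (hx : LipschitzOnWith Lx x (Icc a b))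
    (hy : LipschitzOnWith Ly y (Icc a b)) :
    AbsolutelyContinuousOnInterval (fun t => ‖x t - y t‖ ^ 2 / (1 + lam * t) ^ 2) a b := by
  rw [← uIcc_of_le hab] at hx hy
  have hnorm : LipschitzOnWith (1 * (Lx + Ly)) (fun t => ‖x t - y t‖) (uIcc a b) :=
    lipschitzWith_one_norm.comp_lipschitzOnWith (hx.sub hy)
  have hinv : ContDiffOn ℝ 1 (fun t : ℝ => ((1 + lam * t) ^ 2)⁻¹) (uIcc a b) := by
    refine ContDiffOn.inv (by fun_prop) fun t ht => ?_
    rw [uIcc_of_le hab] at ht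
    have := ha.trans ht.1
    positivity
  have hac := hnorm.absolutelyContinuousOnInterval
  simp only [div_eq_mul_inv, sq ‖_‖]
  exact (hac.mul hac).mul hinv.absolutelyContinuousOnInterval

namespace IsInclusionSolutionOn

variable {a b T δ : ℝ} {f g : ℝ → Space d → ℝ} {x y : ℝ → Space d}

theorem sq_norm_sub_div_le (hx : IsInclusionSolutionOn f lam a b x)
    (hy : IsInclusionSolutionOn g lam a b y) (hlam : 0 ≤ lam) (ha : 0 ≤ a) (hab : a ≤ b)
    (hfg : ∀ t ∈ Ioo a b, ∀ z, |f t z - g t z| ≤ δ) :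
    ‖x b - y b‖ ^ 2 / (1 + lam * b) ^ 2 ≤
      ‖x a - y a‖ ^ 2 / (1 + lam * a) ^ 2 + 4 * δ * (b - a) := by
  obtain ⟨Lx, hLx⟩ := hx.lipschitz
  obtain ⟨Ly, hLy⟩ := hy.lipschitz
  rw [← sub_le_iff_le_add']
  refine sub_le_mul_of_ae_deriv_le hab
    (absolutelyContinuousOnInterval_sq_norm_sub_div hlam ha hab hLx hLy) ?_
  filter_upwards [hx.inclusion, hy.inclusion] with t hxt hyt ht
  obtain ⟨p, hp, hxp⟩ := hxt ht
  obtain ⟨q, hq, hyq⟩ := hyt ht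
  exact deriv_sq_norm_sub_div_le hlam (ha.trans ht.1.le) (hfg t ht) hp hq hxp hyq

theorem norm_sub_div_le (hx : IsInclusionSolutionOn f lam a b x)
    (hy : IsInclusionSolutionOn f lam a b y) (hlam : 0 ≤ lam) (ha : 0 ≤ a) (hab : a ≤ b) :
    ‖x b - y b‖ / (1 + lam * b) ≤ ‖x a - y a‖ / (1 + lam * a) := by
  have h := hx.sq_norm_sub_div_le hy hlam ha hab (δ := 0) (by simp)
  rw [mul_zero, zero_mul, add_zero, ← div_pow, ← div_pow] at h
  exact le_of_sq_le_sq h (by positivity)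

theorem eq_of_eq (hx : IsInclusionSolutionOn f lam a b x)
    (hy : IsInclusionSolutionOn f lam a b y) (hlam : 0 ≤ lam) (ha : 0 ≤ a) (hab : a ≤ b)
    (h : x a = y a) : x b = y b := by
  have hle := hx.norm_sub_div_le hy hlam ha hab
  have : 0 < 1 + lam * b := by
    have := ha.trans hab
    positivity
  rwa [h, sub_self, norm_zero, zero_div, div_le_iff₀ this, zero_mul, norm_le_zero_iff,
    sub_eq_zero] at hle

theorem norm_sub_le (hx : IsInclusionSolutionOn f lam 0 t x)
    (hy : IsInclusionSolutionOn g lam 0 t y) (hlam : 0 ≤ lam) (ht : t ∈ Icc 0 T)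
    (hxy : x 0 = y 0) (hδ : 0 ≤ δ) (hfg : ∀ s ∈ Ioo 0 T, ∀ z, |f s z - g s z| ≤ δ) :
    ‖x t - y t‖ ≤ (1 + lam * T) * √(4 * δ * T) := by
  have h := hx.sq_norm_sub_div_le hy hlam le_rfl ht.1 fun s hs => hfg s ⟨hs.1, hs.2.trans_le ht.2⟩
  have hlt : 0 < 1 + lam * t := by
    have := ht.1
    positivity
  rw [hxy, sub_self, norm_zero, zero_pow two_ne_zero, zero_div, zero_add, sub_zero, ← div_pow] at h
  calc ‖x t - y t‖ ≤ (1 + lam * t) * √(4 * δ * t) := by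
        rw [← div_le_iff₀' hlt]
        exact Real.le_sqrt_of_sq_le h
    _ ≤ (1 + lam * T) * √(4 * δ * T) := by
        have : 0 ≤ T := ht.1.trans ht.2
        have : 0 ≤ 1 + lam * T := by positivity
        gcongr <;> exact ht.2

end IsInclusionSolutionOn

end Stability

section ViscousFlow

variable {T : ℝ} {x y : ℝ → Space d} {Z Z' : Space d → ℝ → Space d}

/-- `x` is a trajectory of the viscous velocity field on the bounded time interval `[0, T]`, where
Picard's theorem provides it; the equation is not imposed at the endpoints. -/
structure IsViscousPath (φ : Space d → ℝ) (ε T : ℝ) (x : ℝ → Space d) : Prop where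
  continuousOn : ContinuousOn x (Icc 0 T)
  hasDerivAt : ∀ t ∈ Ioo 0 T, HasDerivAt x (gradient (viscousPotential φ ε t) (x t)) t

namespace IsViscousPath

theorem mono (hx : IsViscousPath φ ε T x) {S : ℝ} (hS : S ≤ T) : IsViscousPath φ ε S x where
  continuousOn := hx.continuousOn.mono (Icc_subset_Icc_right hS)
  hasDerivAt t ht := hx.hasDerivAt t ⟨ht.1, ht.2.trans_le hS⟩

theorem lipschitzOnWith (hx : IsViscousPath φ ε T x) (hLip : LipschitzWith K φ) (hε : 0 < ε) :
    LipschitzOnWith K x (Icc 0 T) := by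
  rcases le_or_gt T 0 with hT | hT
  · intro s hs t ht
    simp [subsingleton_Icc_of_ge hT hs ht]
  have hIoo : LipschitzOnWith K x (Ioo 0 T) :=
    (convex_Ioo 0 T).lipschitzOnWith_of_nnnorm_hasDerivWithin_le
      (fun t ht => (hx.hasDerivAt t ht).hasDerivWithinAt)
      fun t ht => norm_gradient_viscousPotential_le hLip hε ht.1 _
  have hcont := hx.continuousOn
  rw [← closure_Ioo hT.ne] at hcont ⊢
  exact hIoo.closure hcont

theorem isInclusionSolutionOn (hx : IsViscousPath φ ε T x) (hlam : 0 ≤ lam)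
    (hLip : LipschitzWith K φ) (hconc : LambdaConcave lam φ) (hε : 0 < ε) :
    IsInclusionSolutionOn (viscousPotential φ ε) lam 0 T x where
  lipschitz := ⟨K, hx.lipschitzOnWith hLip hε⟩
  inclusion := ae_of_all _ fun t ht => ⟨_,
    gradient_viscousPotential_mem_differential hlam hLip hconc hε ht.1 _, hx.hasDerivAt t ht⟩

theorem eqOn (hx : IsViscousPath φ ε T x) (hy : IsViscousPath φ ε T y) (hlam : 0 ≤ lam)
    (hLip : LipschitzWith K φ) (hconc : LambdaConcave lam φ) (hε : 0 < ε) (hxy : x 0 = y 0) :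
    EqOn x y (Icc 0 T) := fun _ ht =>
  ((hx.mono ht.2).isInclusionSolutionOn hlam hLip hconc hε).eq_of_eq
    ((hy.mono ht.2).isInclusionSolutionOn hlam hLip hconc hε) hlam le_rfl ht.1 hxy

end IsViscousPath

theorem exists_hasDerivWithinAt_scaledMean (hLip : LipschitzWith K φ) (hε : 0 < ε) {S s₀ : ℝ}
    (hs₀ : s₀ ∈ Icc 0 S) (y : Space d) : ∃ α : ℝ → Space d, α s₀ = y ∧
      ∀ s ∈ Icc 0 S, HasDerivWithinAt α ((2 : ℝ) • scaledMean φ ε s (α s)) (Icc 0 S) s := by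
  obtain ⟨M, hM⟩ := exists_norm_scaledMean_le hLip hε S
  obtain ⟨C, hC⟩ := exists_lipschitzOnWith_scaledMean hLip hε S
  have hbound : ∀ s ∈ Icc 0 S, ∀ x, ‖(2 : ℝ) • scaledMean φ ε s x‖ ≤ 2 * M := fun s hs x => by
    rw [norm_smul, Real.norm_ofNat]
    exact mul_le_mul_of_nonneg_left (hM s hs x) zero_le_two
  have hlip : LipschitzOnWith (‖(2 : ℝ)‖₊ * C)
      (fun p : ℝ × Space d => (2 : ℝ) • scaledMean φ ε p.1 p.2) (Icc 0 S ×ˢ univ) :=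
    (lipschitzWith_smul (2 : ℝ)).comp_lipschitzOnWith hC
  have hslice : ∀ s ∈ Icc 0 S, LipschitzWith (‖(2 : ℝ)‖₊ * C)
      fun x => (2 : ℝ) • scaledMean φ ε s x := fun s hs x x' => by
    simpa [Prod.edist_eq] using
      hlip (x := (s, x)) ⟨hs, mem_univ x⟩ (y := (s, x')) ⟨hs, mem_univ x'⟩
  have hcont : ∀ x, ContinuousOn (fun s => (2 : ℝ) • scaledMean φ ε s x) (Icc 0 S) := fun x =>
    hlip.continuousOn.comp (f := fun s => (s, x)) (by fun_prop) fun s hs => ⟨hs, mem_univ x⟩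
  exact exists_hasDerivWithinAt_of_bounded_of_lipschitz (M := 2 * M)
    (f := fun s x => (2 : ℝ) • scaledMean φ ε s x) hbound hslice hcont hs₀ y

theorem exists_isViscousPath (hLip : LipschitzWith K φ) (hε : 0 < ε) {t₀ : ℝ}
    (ht₀ : t₀ ∈ Icc 0 T) (y : Space d) : ∃ x, IsViscousPath φ ε T x ∧ x t₀ = y := by
  obtain ⟨α, hα₀, hα⟩ := exists_hasDerivWithinAt_scaledMean (S := √T) (s₀ := √t₀) hLip hε
    ⟨Real.sqrt_nonneg _, Real.sqrt_le_sqrt ht₀.2⟩ y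
  refine ⟨fun t => α (√t), ⟨?_, fun t ht => ?_⟩, hα₀⟩
  · have hcont : ContinuousOn α (Icc 0 (√T)) := fun s hs => (hα s hs).continuousWithinAt
    exact hcont.comp Real.continuous_sqrt.continuousOn fun t ht =>
      ⟨Real.sqrt_nonneg _, Real.sqrt_le_sqrt ht.2⟩
  · have hs : 0 < √t := Real.sqrt_pos.2 ht.1
    have hsT : √t < √T := Real.sqrt_lt_sqrt ht.1.le ht.2
    have hαt := (hα (√t) ⟨hs.le, hsT.le⟩).hasDerivAt (Icc_mem_nhds hs hsT)
    have hgrad := gradient_viscousPotential_sq hLip hε hs (α √t)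
    rw [Real.sq_sqrt ht.1.le] at hgrad
    rw [hgrad]
    refine (hαt.scomp t (Real.hasDerivAt_sqrt ht.1.ne')).congr_deriv ?_
    rw [smul_smul]
    congr 1
    field_simp

theorem isViscousFlow_of_isViscousPath (h0 : ∀ y, Z y 0 = y)
    (hZ : ∀ y T, IsViscousPath φ ε T (Z y)) : IsViscousFlow φ ε Z where
  initial := h0
  continuousOn y t ht := by
    refine ((hZ y (t + 1)).continuousOn t ⟨ht, by linarith⟩).mono_of_mem_nhdsWithin ?_
    rw [← Ici_inter_Iic]
    exact inter_mem_nhdsWithin _ (Iic_mem_nhds (lt_add_one t))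
  hasDerivAt y t ht := (hZ y (t + 1)).hasDerivAt t ⟨ht, lt_add_one t⟩

theorem exists_isViscousFlow (hlam : 0 ≤ lam) (hLip : LipschitzWith K φ)
    (hconc : LambdaConcave lam φ) (hε : 0 < ε) :
    ∃ Z : Space d → ℝ → Space d, IsViscousFlow φ ε Z := by
  have hex : ∀ (y : Space d) (T : ℝ), 0 ≤ T → ∃ x, IsViscousPath φ ε T x ∧ x 0 = y :=
    fun y T hT => exists_isViscousPath hLip hε ⟨le_rfl, hT⟩ y
  choose! P hP hP0 using hex
  have hagree : ∀ y T, EqOn (fun t => P y t t) (P y T) (Icc 0 T) := fun y T t ht =>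
    (hP y t ht.1).eqOn ((hP y T (ht.1.trans ht.2)).mono ht.2) hlam hLip hconc hε
      ((hP0 y t ht.1).trans (hP0 y T (ht.1.trans ht.2)).symm) ⟨ht.1, le_rfl⟩
  refine ⟨fun y t => P y t t, isViscousFlow_of_isViscousPath (fun y => hP0 y 0 le_rfl) fun y T =>
    ⟨?_, fun t ht => ?_⟩⟩
  · rcases le_or_gt 0 T with hT | hT
    · exact (hP y T hT).continuousOn.congr (hagree y T)
    · simp [Icc_eq_empty_of_lt hT]
  · have heq : P y t t = P y T t := hagree y T ⟨ht.1.le, ht.2.le⟩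
    rw [heq]
    exact ((hP y T (ht.1.trans ht.2).le).hasDerivAt t ht).congr_of_eventuallyEq
      ((hagree y T).eventuallyEq_of_mem (Icc_mem_nhds ht.1 ht.2))

namespace IsViscousFlow

theorem isViscousPath (hZ : IsViscousFlow φ ε Z) (y : Space d) (T : ℝ) :
    IsViscousPath φ ε T (Z y) where
  continuousOn := (hZ.continuousOn y).mono Icc_subset_Ici_self
  hasDerivAt t ht := hZ.hasDerivAt y t ht.1

theorem lipschitzOnWith (hZ : IsViscousFlow φ ε Z) (hLip : LipschitzWith K φ) (hε : 0 < ε)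
    (y : Space d) : LipschitzOnWith K (Z y) (Ici 0) := fun s hs t ht =>
  (hZ.isViscousPath y (max s t)).lipschitzOnWith hLip hε ⟨hs, le_max_left _ _⟩
    ⟨ht, le_max_right _ _⟩

theorem eq (hZ : IsViscousFlow φ ε Z) (hZ' : IsViscousFlow φ ε Z') (hlam : 0 ≤ lam)
    (hLip : LipschitzWith K φ) (hconc : LambdaConcave lam φ) (hε : 0 < ε) (y : Space d)
    (ht : 0 ≤ t) : Z y t = Z' y t :=
  (hZ.isViscousPath y t).eqOn (hZ'.isViscousPath y t) hlam hLip hconc hε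
    ((hZ.initial y).trans (hZ'.initial y).symm) ⟨ht, le_rfl⟩

theorem surjective (hZ : IsViscousFlow φ ε Z) (hlam : 0 ≤ lam) (hLip : LipschitzWith K φ)
    (hconc : LambdaConcave lam φ) (hε : 0 < ε) (ht : 0 ≤ t) :
    Function.Surjective fun y => Z y t := by
  intro y
  obtain ⟨x, hx, hxt⟩ := exists_isViscousPath hLip hε ⟨ht, le_rfl⟩ y
  exact ⟨x 0, ((hZ.isViscousPath (x 0) t).eqOn hx hlam hLip hconc hε (hZ.initial _)
    ⟨ht, le_rfl⟩).trans hxt⟩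

end IsViscousFlow

end ViscousFlow

section VanishingViscosity

theorem hasDerivAt_neg_half_sq_norm_sub {x : ℝ → Space d} {v z : Space d}
    (hx : HasDerivAt x v t) :
    HasDerivAt (fun s => -(1 / 2) * ‖x s - z‖ ^ 2) (inner ℝ v (z - x t)) t := by
  refine ((hx.sub_const z).norm_sq.const_mul (-(1 / 2) : ℝ)).congr_deriv ?_
  rw [← neg_sub (x t) z, inner_neg_right, real_inner_comm]
  ring

/-- The inner product of the velocity with `z - x` is the derivative of `-|x - z|² / 2`, so the
bounds from below that define the differential pass to the limit although the velocities do not. -/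
theorem mem_differential_of_tendstoUniformlyOn {ι : Type*} {l : Filter ι} [l.NeBot]
    {f : ι → ℝ → Space d → ℝ} {g : ℝ → Space d → ℝ} {x : ι → ℝ → Space d} {y : ℝ → Space d}
    {mu : ℝ → ℝ} {v : Space d} {s : Set ℝ} (hs : s ∈ 𝓝 t)
    (hsol : ∀ᶠ p in l ×ˢ 𝓝 t, ∃ q ∈ differential (mu p.2) (f p.1 p.2) (x p.1 p.2),
      HasDerivAt (x p.1) q p.2)
    (hf : TendstoUniformlyOn (fun i p => f i p.1 p.2) (fun p : ℝ × Space d => g p.1 p.2) l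
      (s ×ˢ univ))
    (hg : ContinuousOn (fun p : ℝ × Space d => g p.1 p.2) (s ×ˢ univ))
    (hx : TendstoUniformlyOn x y l s) (hmu : ContinuousAt mu t) (hy : HasDerivAt y v t) :
    v ∈ differential (mu t) (g t) (y t) := by
  intro z
  have hx_joint : Tendsto (fun p : ι × ℝ => x p.1 p.2) (l ×ˢ 𝓝 t) (𝓝 (y t)) :=
    tendsto_comp_prod_of_tendstoUniformlyOn hx hs hy.continuousAt tendsto_snd
  have hf_joint : ∀ {w : ι × ℝ → Space d} {a : Space d}, Tendsto w (l ×ˢ 𝓝 t) (𝓝 a) →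
      Tendsto (fun p : ι × ℝ => f p.1 p.2 (w p)) (l ×ˢ 𝓝 t) (𝓝 (g t a)) := fun hw =>
    have hst := prod_mem_nhds hs univ_mem
    tendsto_comp_prod_of_tendstoUniformlyOn (g := fun p => (p.2, _)) hf hst (hg.continuousAt hst)
      (tendsto_snd.prodMk_nhds hw)
  have hgap : Tendsto (fun p : ι × ℝ => f p.1 p.2 z - f p.1 p.2 (x p.1 p.2) -
      mu p.2 / 2 * ‖z - x p.1 p.2‖ ^ 2) (l ×ˢ 𝓝 t)
      (𝓝 (g t z - g t (y t) - mu t / 2 * ‖z - y t‖ ^ 2)) :=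
    ((hf_joint tendsto_const_nhds).sub (hf_joint hx_joint)).sub
      (((hmu.tendsto.comp tendsto_snd).div_const 2).mul ((hx_joint.const_sub z).norm.pow 2))
  suffices h : g t z - g t (y t) - mu t / 2 * ‖z - y t‖ ^ 2 ≤ inner ℝ v (z - y t) by linarith
  refine le_of_forall_lt_imp_le_of_dense fun c hc => ?_
  refine le_deriv_of_tendsto (l := l) (h := fun i s => -(1 / 2) * ‖x i s - z‖ ^ 2) ?_ ?_
    (hasDerivAt_neg_half_sq_norm_sub hy)
  · filter_upwards [hsol, hgap.eventually (lt_mem_nhds hc)] with p ⟨q, hq, hqx⟩ hcp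
    exact ⟨_, by linarith [hq z], hasDerivAt_neg_half_sq_norm_sub hqx⟩
  · filter_upwards [hs] with r hr
    exact (((hx.tendsto_at hr).sub_const z).norm.pow 2).const_mul _

namespace IsLipschitzSolution

variable {x x' : ℝ → Space d} {y y' : Space d} {a b : ℝ}

theorem isInclusionSolutionOn (hx : IsLipschitzSolution φ lam y x) (ha : 0 ≤ a) :
    IsInclusionSolutionOn (hopfLax φ) lam a b x where
  lipschitz := hx.lipschitz.imp fun _ hL => hL.mono fun _ ht => ha.trans ht.1
  inclusion := ((ae_restrict_iff' measurableSet_Ioi).1 hx.inclusion).mono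
    fun _ h ht => h (ha.trans_lt ht.1)

theorem norm_sub_div_le (hx : IsLipschitzSolution φ lam y x)
    (hx' : IsLipschitzSolution φ lam y' x') (hlam : 0 ≤ lam) (ha : 0 ≤ a) (hab : a ≤ b) :
    ‖x b - x' b‖ / (1 + lam * b) ≤ ‖x a - x' a‖ / (1 + lam * a) :=
  (hx.isInclusionSolutionOn ha).norm_sub_div_le (hx'.isInclusionSolutionOn ha) hlam ha hab

theorem norm_sub_div_le_norm_sub (hx : IsLipschitzSolution φ lam y x)
    (hx' : IsLipschitzSolution φ lam y' x') (hlam : 0 ≤ lam) (ht : 0 ≤ t) :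
    ‖x t - x' t‖ / (1 + lam * t) ≤ ‖y - y'‖ := by
  simpa only [hx.initial, hx'.initial, mul_zero, add_zero, div_one] using
    hx.norm_sub_div_le hx' hlam le_rfl ht

theorem eq_of_eq (hx : IsLipschitzSolution φ lam y x) (hx' : IsLipschitzSolution φ lam y' x')
    (hlam : 0 ≤ lam) (ha : 0 ≤ a) (hab : a ≤ b) (h : x a = x' a) : x b = x' b :=
  (hx.isInclusionSolutionOn ha).eq_of_eq (hx'.isInclusionSolutionOn ha) hlam ha hab h

theorem eq (hx : IsLipschitzSolution φ lam y x) (hx' : IsLipschitzSolution φ lam y x')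
    (hlam : 0 ≤ lam) (ht : 0 ≤ t) : x t = x' t :=
  hx.eq_of_eq hx' hlam le_rfl ht (hx.initial.trans hx'.initial.symm)

end IsLipschitzSolution

section InviscidFlow

variable {T : ℝ} {X : Space d → ℝ → Space d} {Z : ℝ → Space d → ℝ → Space d}

theorem uniformCauchySeqOn_viscousFlow (hlam : 0 ≤ lam) (hLip : LipschitzWith K φ)
    (hconc : LambdaConcave lam φ) (hZ : ∀ ε > 0, IsViscousFlow φ ε (Z ε)) (hT : 0 < T) :
    UniformCauchySeqOn (fun ε (p : Space d × ℝ) => Z ε p.1 p.2) (𝓝[>] 0) (univ ×ˢ Icc 0 T) := by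
  intro u hu
  obtain ⟨η, hη, hηu⟩ := Metric.mem_uniformity_dist.1 hu
  have hsmall : ∀ᶠ δ in 𝓝[>] (0 : ℝ), (1 + lam * T) * √(4 * δ * T) < η := by
    have hcont : Continuous fun δ => (1 + lam * T) * √(4 * δ * T) := by fun_prop
    exact (hcont.tendsto' 0 0 (by simp)).mono_left nhdsWithin_le_nhds (gt_mem_nhds hη)
  obtain ⟨δ, hδη, hδ⟩ := (hsmall.and self_mem_nhdsWithin).exists
  have hpot := (tendstoUniformlyOn_viscousPotential hLip hT).uniformCauchySeqOn _
    (Metric.dist_mem_uniformity hδ)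
  filter_upwards [hpot, prod_mem_prod self_mem_nhdsWithin self_mem_nhdsWithin]
    with ⟨ε₁, ε₂⟩ hclose ⟨hε₁, hε₂⟩ ⟨y, t⟩ ⟨_, ht⟩
  refine hηu ?_
  rw [dist_eq_norm]
  refine lt_of_le_of_lt ?_ hδη
  exact (((hZ ε₁ hε₁).isViscousPath y t).isInclusionSolutionOn hlam hLip hconc hε₁).norm_sub_le
    (((hZ ε₂ hε₂).isViscousPath y t).isInclusionSolutionOn hlam hLip hconc hε₂) hlam ht
    (((hZ ε₁ hε₁).initial y).trans ((hZ ε₂ hε₂).initial y).symm) (le_of_lt hδ)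
    fun s hs z => (hclose (s, z) ⟨⟨hs.1, hs.2.le⟩, mem_univ z⟩).le

/-- `X` is the vanishing viscosity limit of the Lagrangian flows. By uniqueness of the viscous flow
(`IsViscousFlow.eq`) it does not matter which flows `Z ε` are taken. -/
def IsInviscidFlow (φ : Space d → ℝ) (X : Space d → ℝ → Space d) : Prop :=
  ∃ Z : ℝ → Space d → ℝ → Space d, (∀ ε > 0, IsViscousFlow φ ε (Z ε)) ∧
    ∀ T, TendstoUniformlyOn (fun ε p => Z ε p.1 p.2) (fun p => X p.1 p.2) (𝓝[>] 0)
      (univ ×ˢ Icc 0 T)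

theorem exists_isInviscidFlow (hlam : 0 ≤ lam) (hLip : LipschitzWith K φ)
    (hconc : LambdaConcave lam φ) : ∃ X, IsInviscidFlow φ X := by
  choose! Z hZ using fun ε (hε : 0 < ε) => exists_isViscousFlow hlam hLip hconc hε
  have hcauchy : ∀ T, UniformCauchySeqOn (fun ε (p : Space d × ℝ) => Z ε p.1 p.2) (𝓝[>] 0)
      (univ ×ˢ Icc 0 T) := fun T =>
    (uniformCauchySeqOn_viscousFlow hlam hLip hconc hZ
      (lt_max_of_lt_right one_pos : 0 < max T 1)).mono
      (prod_mono_right (Icc_subset_Icc_right (le_max_left T 1)))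
  have hlim : ∀ y t, 0 ≤ t → ∃ p, Tendsto (fun ε => Z ε y t) (𝓝[>] 0) (𝓝 p) := fun y t ht =>
    cauchy_map_iff_exists_tendsto.1
      ((hcauchy t).cauchy_map (x := (y, t)) ⟨mem_univ y, ht, le_rfl⟩)
  choose! X hX using hlim
  exact ⟨X, Z, hZ, fun T => (hcauchy T).tendstoUniformlyOn_of_tendsto
    fun p hp => hX p.1 p.2 hp.2.1⟩

namespace IsInviscidFlow

theorem tendstoUniformlyOn (hX : IsInviscidFlow φ X) (hlam : 0 ≤ lam) (hLip : LipschitzWith K φ)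
    (hconc : LambdaConcave lam φ) (hZ : ∀ ε > 0, IsViscousFlow φ ε (Z ε)) (T : ℝ) :
    TendstoUniformlyOn (fun ε p => Z ε p.1 p.2) (fun p => X p.1 p.2) (𝓝[>] 0)
      (univ ×ˢ Icc 0 T) := by
  obtain ⟨Z', hZ', hZX⟩ := hX
  refine (hZX T).congr ?_
  filter_upwards [self_mem_nhdsWithin] with ε hε p hp
  exact (hZ' ε hε).eq (hZ ε hε) hlam hLip hconc hε p.1 hp.2.1

theorem tendstoUniformlyOn_of_isCompact (hX : IsInviscidFlow φ X) (hlam : 0 ≤ lam)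
    (hLip : LipschitzWith K φ) (hconc : LambdaConcave lam φ)
    (hZ : ∀ ε > 0, IsViscousFlow φ ε (Z ε)) {C : Set (Space d × ℝ)} (hC : IsCompact C)
    (hC₀ : C ⊆ univ ×ˢ Ici 0) :
    TendstoUniformlyOn (fun ε p => Z ε p.1 p.2) (fun p => X p.1 p.2) (𝓝[>] 0) C := by
  obtain ⟨T, hT⟩ := (hC.image continuous_snd).bddAbove
  exact (hX.tendstoUniformlyOn hlam hLip hconc hZ T).mono fun p hp =>
    ⟨mem_univ _, (hC₀ hp).2, hT (mem_image_of_mem _ hp)⟩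

theorem initial (hX : IsInviscidFlow φ X) (y : Space d) : X y 0 = y := by
  obtain ⟨Z, hZ, hZX⟩ := hX
  refine tendsto_nhds_unique_of_eventuallyEq
    ((hZX 0).tendsto_at (x := (y, 0)) ⟨mem_univ y, le_rfl, le_rfl⟩) tendsto_const_nhds ?_
  filter_upwards [self_mem_nhdsWithin] with ε hε using (hZ ε hε).initial y

theorem lipschitzOnWith (hX : IsInviscidFlow φ X) (hLip : LipschitzWith K φ) (y : Space d) :
    LipschitzOnWith K (X y) (Ici 0) := by
  obtain ⟨Z, hZ, hZX⟩ := hX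
  have hlim : ∀ t ∈ Ici (0 : ℝ), Tendsto (fun ε => Z ε y t) (𝓝[>] 0) (𝓝 (X y t)) := fun t ht =>
    (hZX t).tendsto_at (x := (y, t)) ⟨mem_univ y, ht, le_rfl⟩
  refine LipschitzOnWith.of_dist_le_mul fun s hs t ht => ?_
  refine le_of_tendsto ((hlim s hs).dist (hlim t ht)) ?_
  filter_upwards [self_mem_nhdsWithin] with ε hε
  exact ((hZ ε hε).lipschitzOnWith hLip hε y).dist_le_mul s hs t ht

theorem mem_differential (hX : IsInviscidFlow φ X) (hlam : 0 ≤ lam) (hLip : LipschitzWith K φ)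
    (hconc : LambdaConcave lam φ) {y v : Space d} (ht : 0 < t) (hv : HasDerivAt (X y) v t) :
    v ∈ differential (lam / (1 + lam * t)) (hopfLax φ t) (X y t) := by
  obtain ⟨Z, hZ, hZX⟩ := hX
  have hpot := tendstoUniformlyOn_viscousPotential hLip (ht.trans (lt_add_one t))
  have hpath : TendstoUniformlyOn (fun ε s => Z ε y s) (X y) (𝓝[>] 0) (Icc 0 (t + 1)) :=
    ((hZX (t + 1)).comp fun s => (y, s)).mono fun s hs => ⟨mem_univ y, hs⟩
  refine mem_differential_of_tendstoUniformlyOn (mu := fun s => lam / (1 + lam * s))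
    (Ioo_mem_nhds ht (lt_add_one t)) ?_ (hpot.mono (prod_mono_left Ioo_subset_Ioc_self))
    ((continuousOn_hopfLax hLip).mono (prod_mono_left Ioo_subset_Ioi_self))
    (hpath.mono Ioo_subset_Icc_self) (ContinuousAt.div (by fun_prop) (by fun_prop) ?_) hv
  · filter_upwards [prod_mem_prod self_mem_nhdsWithin (Ioi_mem_nhds ht)] with ⟨ε, s⟩ ⟨hε, hs⟩
    exact ⟨_, gradient_viscousPotential_mem_differential hlam hLip hconc hε hs _,
      (hZ ε hε).hasDerivAt y s hs⟩
  · positivity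

theorem isLipschitzSolution (hX : IsInviscidFlow φ X) (hlam : 0 ≤ lam) (hLip : LipschitzWith K φ)
    (hconc : LambdaConcave lam φ) (y : Space d) : IsLipschitzSolution φ lam y (X y) where
  lipschitz := ⟨K, hX.lipschitzOnWith hLip y⟩
  initial := hX.initial y
  inclusion := by
    rw [ae_restrict_iff' measurableSet_Ioi]
    filter_upwards [(hX.lipschitzOnWith hLip y).ae_differentiableWithinAt_of_mem] with t hdiff ht
    have hv := ((hdiff (mem_Ici.2 (le_of_lt ht))).differentiableAt (Ici_mem_nhds ht)).hasDerivAt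
    exact ⟨_, hX.mem_differential hlam hLip hconc ht hv, hv⟩

theorem lipschitzWith (hX : IsInviscidFlow φ X) (hlam : 0 ≤ lam) (hLip : LipschitzWith K φ)
    (hconc : LambdaConcave lam φ) (ht : 0 ≤ t) :
    LipschitzWith (1 + lam * t).toNNReal fun y => X y t := by
  have hpos : 0 < 1 + lam * t := by positivity
  refine LipschitzWith.of_dist_le' fun y z => ?_
  rw [dist_eq_norm, dist_eq_norm, ← div_le_iff₀' hpos]
  exact (hX.isLipschitzSolution hlam hLip hconc y).norm_sub_div_le_norm_sub
    (hX.isLipschitzSolution hlam hLip hconc z) hlam ht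

theorem surjective (hX : IsInviscidFlow φ X) (hlam : 0 ≤ lam) (hLip : LipschitzWith K φ)
    (hconc : LambdaConcave lam φ) (ht : 0 ≤ t) : Function.Surjective fun y => X y t := by
  have hR : ∀ y, ‖X y t - y‖ ≤ K * t := fun y => by
    have h := (hX.lipschitzOnWith hLip y).dist_le_mul t ht 0 self_mem_Ici
    rwa [hX.initial, dist_eq_norm, dist_zero_right, Real.norm_of_nonneg ht] at h
  have hcont := (hX.lipschitzWith hlam hLip hconc ht).continuous
  obtain ⟨Z, hZ, hZX⟩ := hX
  have hlim : TendstoUniformly (fun ε y => Z ε y t) (fun y => X y t) (𝓝[>] 0) :=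
    tendstoUniformlyOn_univ.1 (((hZX t).comp fun y => (y, t)).mono
      fun y _ => ⟨mem_univ y, ht, le_rfl⟩)
  refine surjective_of_tendstoUniformly hlim ?_ hcont hR
  filter_upwards [self_mem_nhdsWithin] with ε hε using
    (hZ ε hε).surjective hlam hLip hconc hε ht

theorem locallyLipschitzOn (hX : IsInviscidFlow φ X) (hlam : 0 ≤ lam) (hLip : LipschitzWith K φ)
    (hconc : LambdaConcave lam φ) :
    LocallyLipschitzOn (univ ×ˢ Ici 0) fun p : Space d × ℝ => X p.1 p.2 := by
  rintro ⟨y₀, t₀⟩ -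
  refine ⟨(1 + lam * (t₀ + 1)).toNNReal + K, univ ×ˢ Ico 0 (t₀ + 1), ?_,
    lipschitzOnWith_prod (fun t ht => ?_)
      fun y _ => (hX.lipschitzOnWith hLip y).mono Ico_subset_Ici_self⟩
  · rw [nhdsWithin_prod_eq, nhdsWithin_univ, ← Ici_inter_Iio]
    exact prod_mem_prod univ_mem
      (inter_mem_nhdsWithin _ (Iio_mem_nhds (lt_add_one t₀)))
  · refine ((hX.lipschitzWith hlam hLip hconc ht.1).weaken ?_).lipschitzOnWith
    have := ht.2.le
    gcongr

end IsInviscidFlow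

end InviscidFlow

end VanishingViscosity

end Adhesion

end

theorem theorem2p4 {d : ℕ} (φ : Adhesion.Space d → ℝ) (K : NNReal) (lam : ℝ) (hlam : 0 ≤ lam)
    (hLip : LipschitzWith K φ) (hconc : Adhesion.LambdaConcave lam φ) :
    -- for every `ε > 0` the viscous Lagrangian flow `X^ε` exists and is unique on `[0, ∞)`
    (∀ ε > 0, ∃ Z : Adhesion.Space d → ℝ → Adhesion.Space d, Adhesion.IsViscousFlow φ ε Z ∧
      ∀ Z', Adhesion.IsViscousFlow φ ε Z' → ∀ y, ∀ t ≥ 0, Z' y t = Z y t) ∧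
    ∃ X : Adhesion.Space d → ℝ → Adhesion.Space d,
      -- (a) convergence of the viscous flows `X^ε`, locally uniformly
      (∀ Xε : ℝ → Adhesion.Space d → ℝ → Adhesion.Space d,
        (∀ ε > 0, Adhesion.IsViscousFlow φ ε (Xε ε)) →
          (∀ y, ∀ t ≥ 0,
            Filter.Tendsto (fun ε => Xε ε y t) (nhdsWithin 0 (Set.Ioi 0)) (nhds (X y t))) ∧
          ∀ C : Set (Adhesion.Space d × ℝ), IsCompact C → C ⊆ Set.univ ×ˢ Set.Ici 0 →
            TendstoUniformlyOn (fun ε p => Xε ε p.1 p.2) (fun p => X p.1 p.2)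
              (nhdsWithin 0 (Set.Ioi 0)) C) ∧
      -- (b) surjectivity
      (∀ t ≥ 0, Function.Surjective (fun y => X y t)) ∧
      -- (c) local Lipschitz continuity, in the form (i), (ii), with stickiness
      LocallyLipschitzOn (Set.univ ×ˢ Set.Ici 0)
        (fun p : Adhesion.Space d × ℝ => X p.1 p.2) ∧
      (∀ y, LipschitzOnWith K (X y) (Set.Ici 0)) ∧
      (∀ s t, 0 ≤ s → s < t → ∀ y z,
        ‖X y t - X z t‖ / (1 + lam * t) ≤ ‖X y s - X z s‖ / (1 + lam * s) ∧
        ‖X y s - X z s‖ / (1 + lam * s) ≤ ‖y - z‖) ∧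
      (∀ y z, ∀ s ≥ 0, X y s = X z s → ∀ t ≥ s, X y t = X z t) ∧
      -- (d) each path is the unique Lipschitz solution of the differential inclusion
      (∀ y, Adhesion.IsLipschitzSolution φ lam y (X y) ∧
        ∀ x, Adhesion.IsLipschitzSolution φ lam y x → ∀ t ≥ 0, x t = X y t) := by
  refine ⟨fun ε hε => ?_, ?_⟩
  · obtain ⟨Z, hZ⟩ := Adhesion.exists_isViscousFlow hlam hLip hconc hε
    exact ⟨Z, hZ, fun Z' hZ' y t ht => hZ'.eq hZ hlam hLip hconc hε y ht⟩
  obtain ⟨X, hX⟩ := Adhesion.exists_isInviscidFlow hlam hLip hconc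
  have hsol := hX.isLipschitzSolution hlam hLip hconc
  refine ⟨X, fun Xε hXε => ⟨fun y t ht => ?_, fun C =>
      hX.tendstoUniformlyOn_of_isCompact hlam hLip hconc hXε⟩,
    fun t ht => hX.surjective hlam hLip hconc ht,
    hX.locallyLipschitzOn hlam hLip hconc,
    hX.lipschitzOnWith hLip,
    fun s t hs hst y z => ⟨(hsol y).norm_sub_div_le (hsol z) hlam hs hst.le,
      (hsol y).norm_sub_div_le_norm_sub (hsol z) hlam hs⟩,
    fun y z s hs h t hst => (hsol y).eq_of_eq (hsol z) hlam hs hst h,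
    fun y => ⟨hsol y, fun x hx t ht => hx.eq (hsol y) hlam ht⟩⟩
  exact (hX.tendstoUniformlyOn hlam hLip hconc hXε t).tendsto_at (x := (y, t))
    ⟨Set.mem_univ y, ht, le_rfl⟩
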